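/- Let $M$ be a smooth $n$-dimensional manifold with an atlas consisting of a single chart. Let $L\colon TM\to\mathbb R$ be positively homogeneous of degree one in the fibres, i.e. $L(\lambda v)=\lambda L(v)$ for $\lambda>0$, and smooth and positive on the slit tangent bundle $TM\setminus 0$. Suppose that for every $p\in M$ the level surfaces $\{v\in T_pM\mid L(v)=c\}$, $c>0$, have non-vanishing Gaussian curvature with respect to some Euclidean structure on $T_pM$ (whether the curvature vanishes does not depend on this structure). Then: 1. For every $p\in M$ and $v\in T_pM\setminus\{0\}$, in linear coordinates $(y^i)$ on $T_pM$, $\operatorname{rank}\left(\frac{\partial^2L}{\partial y^i\partial y^j}(v)\right)=n-1$, and the Hessian of $L|_{T_pM}$ at $v$ descends to a non-degenerate symmetric bilinear form on $T_pM/\langle v\rangle$; that is, $L$ is a pseudo-Finsler function. 2. $L$ is a Finsler function: at every $v\in T_pM\setminus\{0\}$ the Hessian of $\frac12 L^2|_{T_pM}$ is positive definite. 3. $(M,L)$ is projectively flat if and only if there is a coordinate system $(u^i)_{i=1}^n$ on $M$, with induced coordinate system $(x^i,y^i)$ on $TM$, such that on $TM\setminus 0$ the Hamel equations $$\frac{\partial^2L}{\partial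 y^k\partial x^i}\,y^k=\frac{\partial^2L}{\partial y^i\partial x^k}\,y^k\qquad(i=1,\dots,n,\ \text{summation over }k)$$ hold. Likewise, $(M,L)$ is locally projectively flat if and only if every point of $M$ has an open neighbourhood with a coordinate system satisfying the Hamel equations. Here a geodesic of $L$ is a curve $\gamma\colon I\to M$ of class $C^2$ on a non-degenerate interval $I$ which is an extremal of the length functional $\int L(\dot\gamma(t))\,dt$, i.e. satisfies the Euler–Lagrange equations $\frac{\partial L}{\partial x^i}\circ\dot\gamma-\left(\frac{\partial L}{\partial y^i}\circ\dot\gamma\right)'=0$ in every coordinate system, and for which $L(\dot\gamma(t))$ is a positive constant. A coordinate system $u=(u^i)$ on an open set $U\subseteq M$ is rectilinear if for every geodesic $\gamma\colon I\to U$ there are $a,b\in\mathbb R^n$ with $a\neq0$ and a smooth strictly monotone function $f\colon I\to\mathbb R$ such that $u(\gamma(t))=f(t)a+b$ for all $t\in I$. $(M,L)$ is projectively flat if there is a rectilinear coordinate system on all of $M$, and locally projectively flat if $M$ has an atlas of rectilinear coordinate systems. -/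

import Mathlib

open Set
open scoped Manifold ContDiff Gradient

noncomputable section

namespace FinslerSpace

/-! ### Level surfaces in Euclidean space and their Gaussian curvature -/

section LevelSurface

variable {n : ℕ}

/-- The unit normal field `∇f / ‖∇f‖` of the level surfaces of `f`. -/
def unitNormal (f : EuclideanSpace ℝ (Fin n) → ℝ) (v : EuclideanSpace ℝ (Fin n)) :
    EuclideanSpace ℝ (Fin n) :=
  ‖∇ f v‖⁻¹ • ∇ f v

/-- The tangent space at `v` of the level surface of `f` through `v`. -/
def levelTangent (f : EuclideanSpace ℝ (Fin n) → ℝ) (v : EuclideanSpace ℝ (Fin n)) :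
    Submodule ℝ (EuclideanSpace ℝ (Fin n)) :=
  LinearMap.ker (fderiv ℝ f v).toLinearMap

/-- The Weingarten map `w ↦ -dN(w)` of the level surface of `f` through `v`, where `N` is the unit
normal field. (As `N` has unit length, `dN` maps the tangent space into itself, so that the
orthogonal projection only serves to give the map its codomain.) -/
def weingarten (f : EuclideanSpace ℝ (Fin n) → ℝ) (v : EuclideanSpace ℝ (Fin n)) :
    levelTangent f v →ₗ[ℝ] levelTangent f v :=
  -((levelTangent f v).orthogonalProjectionOnto ∘L fderiv ℝ (unitNormal f) v ∘L
      (levelTangent f v).subtypeL).toLinearMap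

/-- The Gaussian (Gauss–Kronecker) curvature at `v` of the level surface of `f` through `v`:
the determinant of the Weingarten map. -/
def gaussCurvature (f : EuclideanSpace ℝ (Fin n) → ℝ) (v : EuclideanSpace ℝ (Fin n)) : ℝ :=
  LinearMap.det (weingarten f v)

end LevelSurface

/-! ### Lagrange functions on the tangent bundle -/

section Lagrange

variable {n : ℕ} {M : Type*} [TopologicalSpace M] [ChartedSpace (EuclideanSpace ℝ (Fin n)) M]
  [IsManifold (𝓡 n) ∞ M]

/-- The restriction of `L` to the tangent space at `p`. -/
def fiberFun (L : TangentBundle (𝓡 n) M → ℝ) (p : M) : EuclideanSpace ℝ (Fin n) → ℝ :=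
  fun v => L ⟨p, v⟩

/-- Smoothness on the slit tangent bundle. -/
def SmoothOnSlit (L : TangentBundle (𝓡 n) M → ℝ) : Prop :=
  ContMDiffOn (𝓡 n).tangent 𝓘(ℝ, ℝ) ∞ L {v | v.2 ≠ 0}

/-- Positivity on the slit tangent bundle. -/
def PositiveOnSlit (L : TangentBundle (𝓡 n) M → ℝ) : Prop :=
  ∀ v : TangentBundle (𝓡 n) M, v.2 ≠ 0 → 0 < L v

/-- Positive homogeneity of degree one in the fibres. -/
def PosHomogeneous (L : TangentBundle (𝓡 n) M → ℝ) : Prop :=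
  ∀ (p : M) (v : TangentSpace (𝓡 n) p) (r : ℝ), 0 < r → L ⟨p, r • v⟩ = r * L ⟨p, v⟩

/-- The level surfaces of `L` in the tangent spaces have non-vanishing Gaussian curvature, the
curvature being taken with respect to some Euclidean structure on each tangent space `T_p M`.
A Euclidean structure is given by linear coordinates `A`, declared to be orthonormal; whether the
curvature vanishes does not depend on it. -/
def LevelSurfacesCurved (L : TangentBundle (𝓡 n) M → ℝ) : Prop :=
  ∀ p : M, ∃ A : EuclideanSpace ℝ (Fin n) ≃L[ℝ] EuclideanSpace ℝ (Fin n),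
    ∀ c : ℝ, 0 < c → ∀ v : EuclideanSpace ℝ (Fin n), fiberFun L p (A v) = c →
      gaussCurvature (fiberFun L p ∘ A) v ≠ 0

/-- The Hessian at `v` of the restriction to `T_p M` of a function on `TM`, as a bilinear form. -/
def fiberHessian (L : TangentBundle (𝓡 n) M → ℝ) (p : M) (v : EuclideanSpace ℝ (Fin n)) :
    EuclideanSpace ℝ (Fin n) →L[ℝ] EuclideanSpace ℝ (Fin n) →L[ℝ] ℝ :=
  fderiv ℝ (fderiv ℝ (fiberFun L p)) v

/-- `L` is a pseudo-Finsler function: smooth on the slit tangent bundle, positively homogeneous of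
degree one, and at each `v ≠ 0` the fibre Hessian has radical `ℝ v`, that is, it descends to a
non-degenerate symmetric bilinear form (the reduced Hessian) on `T_p M / ⟨v⟩`. -/
structure IsPseudoFinsler (L : TangentBundle (𝓡 n) M → ℝ) : Prop where
  smooth : SmoothOnSlit L
  homogeneous : PosHomogeneous L
  nondegenerate : ∀ (p : M) (v : EuclideanSpace ℝ (Fin n)), v ≠ 0 →
    ∀ w : EuclideanSpace ℝ (Fin n),
      (∀ w' : EuclideanSpace ℝ (Fin n), fiberHessian L p v w w' = 0) ↔ w ∈ Submodule.span ℝ {v}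

/-- `L` is a Finsler function: smooth and positive on the slit tangent bundle, positively
homogeneous of degree one, and strongly convex, that is, the fibre Hessian of `L² / 2` is positive
definite at every non-zero vector. -/
structure IsFinsler (L : TangentBundle (𝓡 n) M → ℝ) : Prop where
  smooth : SmoothOnSlit L
  positive : PositiveOnSlit L
  homogeneous : PosHomogeneous L
  stronglyConvex : ∀ (p : M) (v : EuclideanSpace ℝ (Fin n)), v ≠ 0 →
    ∀ w : EuclideanSpace ℝ (Fin n), w ≠ 0 →
      0 < fiberHessian (fun u => L u ^ 2 / 2) p v w w

/-! ### Induced coordinates on the tangent bundle -/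

/-- The expression of `L` in the coordinates `(x, y)` on `TM` induced by a chart `φ` of `M`:
`x` ranges over `φ.target` and `y` over `ℝⁿ`. -/
def coordRep (L : TangentBundle (𝓡 n) M → ℝ)
    (φ : OpenPartialHomeomorph M (EuclideanSpace ℝ (Fin n)))
    (x y : EuclideanSpace ℝ (Fin n)) : ℝ :=
  L (tangentMap (𝓡 n) (𝓡 n) φ.symm ⟨x, y⟩)

/-- The partial derivative `∂F/∂xⁱ` of a function `F(x, y)`. -/
def partialX (i : Fin n) (F : EuclideanSpace ℝ (Fin n) → EuclideanSpace ℝ (Fin n) → ℝ)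
    (x y : EuclideanSpace ℝ (Fin n)) : ℝ :=
  fderiv ℝ (fun x' => F x' y) x (EuclideanSpace.single i 1)

/-- The partial derivative `∂F/∂yⁱ` of a function `F(x, y)`. -/
def partialY (i : Fin n) (F : EuclideanSpace ℝ (Fin n) → EuclideanSpace ℝ (Fin n) → ℝ)
    (x y : EuclideanSpace ℝ (Fin n)) : ℝ :=
  fderiv ℝ (fun y' => F x y') y (EuclideanSpace.single i 1)

/-- A coordinate system on an open subset (`φ.source`) of `M`: a smoothly compatible chart. -/
def IsCoordinateSystem (φ : OpenPartialHomeomorph M (EuclideanSpace ℝ (Fin n))) : Prop :=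
  φ ∈ IsManifold.maximalAtlas (𝓡 n) ∞ M

/-- The Hamel equations `∂²L/∂yᵏ∂xⁱ yᵏ = ∂²L/∂yⁱ∂xᵏ yᵏ` (summation over `k`) in the coordinate
system `φ`, on the slit tangent bundle. -/
def HamelEquations (L : TangentBundle (𝓡 n) M → ℝ)
    (φ : OpenPartialHomeomorph M (EuclideanSpace ℝ (Fin n))) : Prop :=
  ∀ x ∈ φ.target, ∀ y : EuclideanSpace ℝ (Fin n), y ≠ 0 → ∀ i : Fin n,
    ∑ k, partialY k (partialX i (coordRep L φ)) x y * y k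
      = ∑ k, partialY i (partialX k (coordRep L φ)) x y * y k

/-! ### Geodesics and projective flatness -/

/-- A (non-degenerate) interval of the real line, of any kind. -/
def IsInterval (I : Set ℝ) : Prop :=
  I.OrdConnected ∧ I.Nontrivial

/-- The velocity vector of the curve `γ : I → M` at `t`. -/
def velocity (γ : ℝ → M) (I : Set ℝ) (t : ℝ) : TangentBundle (𝓡 n) M :=
  ⟨γ t, mfderivWithin 𝓘(ℝ, ℝ) (𝓡 n) γ I t (1 : ℝ)⟩

/-- The curve `γ : I → M` solves at time `t` the Euler–Lagrange equations
`d/dt (∂L/∂yⁱ ∘ γ̇) = ∂L/∂xⁱ ∘ γ̇` of the length functional `∫ L(γ̇(t)) dt`,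
in the coordinate system `φ`. -/
def EulerLagrangeAt (L : TangentBundle (𝓡 n) M → ℝ)
    (φ : OpenPartialHomeomorph M (EuclideanSpace ℝ (Fin n)))
    (γ : ℝ → M) (I : Set ℝ) (t : ℝ) : Prop :=
  ∀ i : Fin n, HasDerivWithinAt
    (fun s => partialY i (coordRep L φ) (φ (γ s)) (derivWithin (φ ∘ γ) I s))
    (partialX i (coordRep L φ) (φ (γ t)) (derivWithin (φ ∘ γ) I t)) I t

/-- `γ : I → M` is a geodesic of `L`: a curve of class `C²` which is an extremal of the length
functional and has positive constant speed. -/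
structure IsGeodesic (L : TangentBundle (𝓡 n) M → ℝ) (γ : ℝ → M) (I : Set ℝ) : Prop where
  contMDiffOn : ContMDiffOn 𝓘(ℝ, ℝ) (𝓡 n) 2 γ I
  speed : ∃ c : ℝ, 0 < c ∧ ∀ t ∈ I, L (velocity γ I t) = c
  extremal : ∀ t ∈ I, ∀ φ : OpenPartialHomeomorph M (EuclideanSpace ℝ (Fin n)),
    IsCoordinateSystem φ → γ t ∈ φ.source → EulerLagrangeAt L φ γ I t

/-- The coordinate system `φ` is rectilinear: it maps every geodesic in its domain to a straight
line, `φ(γ(t)) = f(t) a + b` with `f` smooth and strictly monotone and `a ≠ 0`. -/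
def IsRectilinear (L : TangentBundle (𝓡 n) M → ℝ)
    (φ : OpenPartialHomeomorph M (EuclideanSpace ℝ (Fin n))) : Prop :=
  ∀ (I : Set ℝ) (γ : ℝ → M), IsInterval I → MapsTo γ I φ.source → IsGeodesic L γ I →
    ∃ (f : ℝ → ℝ) (a b : EuclideanSpace ℝ (Fin n)), a ≠ 0 ∧ ContDiffOn ℝ ∞ f I ∧
      (StrictMonoOn f I ∨ StrictAntiOn f I) ∧ ∀ t ∈ I, φ (γ t) = f t • a + b

/-- `(M, L)` is projectively flat: there is a rectilinear coordinate system on all of `M`. -/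
def IsProjectivelyFlat (L : TangentBundle (𝓡 n) M → ℝ) : Prop :=
  ∃ φ : OpenPartialHomeomorph M (EuclideanSpace ℝ (Fin n)),
    IsCoordinateSystem φ ∧ φ.source = univ ∧ IsRectilinear L φ

/-- `(M, L)` is locally projectively flat: there is an atlas of rectilinear coordinate systems. -/
def IsLocallyProjectivelyFlat (L : TangentBundle (𝓡 n) M → ℝ) : Prop :=
  ∀ p : M, ∃ φ : OpenPartialHomeomorph M (EuclideanSpace ℝ (Fin n)),
    IsCoordinateSystem φ ∧ p ∈ φ.source ∧ IsRectilinear L φ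

end Lagrange

end FinslerSpace

end

/-! Homogeneity carries all three parts. By Euler's identity, `L` having degree one and its fibre
derivative degree zero, `dL_v(v) = L(v)` and `Hess L_v(v, ·) = 0`. The Weingarten map is, up to a
non-zero factor, the Hessian restricted to `ker dL_v`, a complement of the line through `v`. Hence
non-vanishing curvature says exactly that the radical of the Hessian is that line
(`IsGauge.radical_of_curved`), and the rank follows.

Strong convexity is a continuity argument (`IsGauge.hessian_sq_half_pos`). The Hessian of `L² / 2`
is `dL ⊗ dL + L · Hess L`, which is now non-degenerate at every non-zero vector. It is positive
definite where `L` is smallest on the Euclidean unit sphere, and its signature cannot change along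
the connected set of non-zero vectors; dimension one is a direct computation.

For flatness, write the Euler–Lagrange equations in coordinates as `L_yy(z, w) + L_xy(y, w) =
L_x(w)`, with velocity `y` and acceleration `z`. Contracted by Euler's identity, the Hamel equations
read `L_xy(y, w) = L_x(w)`. The difference is `L_yy(z, ·) = 0`, so under the Hamel equations `z` is
a multiple of `y` and geodesics are straight lines (`IsLocalLagrangian.exists_line`). Conversely,
every point and non-zero direction is the initial datum of a geodesic
(`IsLocalLagrangian.exists_geodesic`); if it is straight, `z` is a multiple of `y` and the Hamel
equations hold at that datum. -/

noncomputable section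

namespace FinslerSpace

/-! ### Euler identities and Hessians of positively homogeneous functions. -/

section Gauge

theorem two_le_infty : (2 : WithTop ℕ∞) ≤ ∞ := by
  exact WithTop.coe_le_coe.2 (le_top : (2 : ℕ∞) ≤ ⊤)

/-- **Euler's identity** for positively homogeneous functions of natural degree. -/
theorem fderiv_apply_self_of_posHomogeneous {V W : Type*} [NormedAddCommGroup V] [NormedSpace ℝ V]
    [NormedAddCommGroup W] [NormedSpace ℝ W] {g : V → W} {v : V} (k : ℕ)
    (hg : DifferentiableAt ℝ g v) (hom : ∀ r : ℝ, 0 < r → g (r • v) = r ^ k • g v) :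
    fderiv ℝ g v v = (k : ℝ) • g v := by
  have h1 : HasDerivAt (fun r : ℝ => g (r • v)) (fderiv ℝ g v v) 1 := by
    have hl : HasDerivAt (fun r : ℝ => r • v) v 1 := by
      simpa using (hasDerivAt_id (1 : ℝ)).smul_const v
    have hg' : HasFDerivAt g (fderiv ℝ g v) ((1 : ℝ) • v) := by simpa using hg.hasFDerivAt
    exact hg'.comp_hasDerivAt 1 hl
  have h2 : HasDerivAt (fun r : ℝ => r ^ k • g v) ((k : ℝ) • g v) 1 := by
    simpa using (hasDerivAt_pow k (1 : ℝ)).smul_const (g v)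
  refine h1.unique (h2.congr_of_eventuallyEq ?_)
  filter_upwards [lt_mem_nhds (zero_lt_one' ℝ)] with r hr using hom r hr

variable {V : Type*} [NormedAddCommGroup V] [NormedSpace ℝ V]

/-- A positive, positively homogeneous function on a vector space, smooth away from the origin. -/
structure IsGauge (f : V → ℝ) : Prop where
  smooth : ContDiffOn ℝ ∞ f {0}ᶜ
  pos : ∀ v, v ≠ 0 → 0 < f v
  hom : ∀ v, ∀ r : ℝ, 0 < r → f (r • v) = r * f v

variable {f : V → ℝ} {v : V}

namespace IsGauge

theorem contDiffAt (hf : IsGauge f) (hv : v ≠ 0) : ContDiffAt ℝ ∞ f v :=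
  (hf.smooth v hv).contDiffAt (isOpen_compl_singleton.mem_nhds hv)

theorem differentiableAt (hf : IsGauge f) (hv : v ≠ 0) : DifferentiableAt ℝ f v :=
  (hf.contDiffAt hv).differentiableAt (by simp)

theorem contDiffAt_fderiv (hf : IsGauge f) (hv : v ≠ 0) : ContDiffAt ℝ ∞ (fderiv ℝ f) v :=
  (hf.contDiffAt hv).fderiv_right (by simp)

theorem differentiableAt_fderiv (hf : IsGauge f) (hv : v ≠ 0) :
    DifferentiableAt ℝ (fderiv ℝ f) v :=
  (hf.contDiffAt_fderiv hv).differentiableAt (by simp)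

theorem fderiv_self (hf : IsGauge f) (hv : v ≠ 0) : fderiv ℝ f v v = f v := by
  simpa using fderiv_apply_self_of_posHomogeneous 1 (hf.differentiableAt hv)
    (fun r hr => by simpa using hf.hom v r hr)

theorem fderiv_smul (hf : IsGauge f) (hv : v ≠ 0) {r : ℝ} (hr : 0 < r) :
    fderiv ℝ f (r • v) = fderiv ℝ f v := by
  have h1 : HasFDerivAt (fun u => f (r • u))
      ((fderiv ℝ f (r • v)).comp (r • ContinuousLinearMap.id ℝ V)) v := by
    have hl : HasFDerivAt (fun u : V => r • u) (r • ContinuousLinearMap.id ℝ V) v :=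
      (hasFDerivAt_id v).const_smul r
    exact (hf.differentiableAt (smul_ne_zero hr.ne' hv)).hasFDerivAt.comp v hl
  have h2 : HasFDerivAt (fun u => f (r • u)) (r • fderiv ℝ f v) v := by
    have := (hf.differentiableAt hv).hasFDerivAt.const_mul r
    refine this.congr_of_eventuallyEq (Filter.Eventually.of_forall fun u => hf.hom u r hr)
  have h := h1.unique h2
  ext w
  have := DFunLike.congr_fun h w
  simpa [hr.ne'] using this

/-- The differential is homogeneous of degree zero, so this is Euler's identity with `k = 0`. -/
theorem hessian_self (hf : IsGauge f) (hv : v ≠ 0) : fderiv ℝ (fderiv ℝ f) v v = 0 := by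
  simpa using fderiv_apply_self_of_posHomogeneous 0 (hf.differentiableAt_fderiv hv)
    (fun r hr => by simpa using hf.fderiv_smul hv hr)

theorem hessian_symm (hf : IsGauge f) (hv : v ≠ 0) (w w' : V) :
    fderiv ℝ (fderiv ℝ f) v w w' = fderiv ℝ (fderiv ℝ f) v w' w :=
  ((hf.contDiffAt hv).isSymmSndFDerivAt (by simpa using two_le_infty)).eq w w'

/-- The radical of the Hessian consists of the multiples of the base vector as soon as the
Hessian is non-degenerate on the tangent space of the level surface. -/
theorem radical_of_tangent (hf : IsGauge f) (hv : v ≠ 0)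
    (hnd : ∀ w, fderiv ℝ f v w = 0 →
      (∀ w', fderiv ℝ f v w' = 0 → fderiv ℝ (fderiv ℝ f) v w w' = 0) → w = 0) (w : V) :
    (∀ w', fderiv ℝ (fderiv ℝ f) v w w' = 0) ↔ w ∈ Submodule.span ℝ {v} := by
  constructor
  · intro h
    have hfv := (hf.pos v hv).ne'
    -- Since `df_v(v) = f v`, this multiple of `v` is the one whose removal makes `w` tangent;
    -- removing it does not affect the Hessian, as `v` lies in the radical.
    have := hnd (w - (fderiv ℝ f v w / f v) • v)
      (by rw [map_sub, map_smul, hf.fderiv_self hv, smul_eq_mul, div_mul_cancel₀ _ hfv, sub_self])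
      (fun w' _ => by simp [hf.hessian_self hv, h])
    rw [sub_eq_zero] at this
    rw [this]
    exact Submodule.smul_mem _ _ (Submodule.mem_span_singleton_self v)
  · intro h w'
    obtain ⟨a, rfl⟩ := Submodule.mem_span_singleton.1 h
    simp [hf.hessian_self hv]

theorem comp_equiv {V' : Type*} [NormedAddCommGroup V'] [NormedSpace ℝ V'] (hf : IsGauge f)
    (A : V' ≃L[ℝ] V) : IsGauge (f ∘ A) where
  smooth := hf.smooth.comp A.contDiff.contDiffOn (fun v hv => by simpa using hv)
  pos v hv := hf.pos _ (by simpa using hv)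
  hom v r hr := by simp [hf.hom _ r hr]

theorem fderiv_sq_half (hf : IsGauge f) (hv : v ≠ 0) :
    fderiv ℝ (fun u => f u ^ 2 / 2) v = f v • fderiv ℝ f v := by
  have h := ((hf.differentiableAt hv).hasFDerivAt.pow 2).mul_const (1 / 2 : ℝ)
  have he : (fun u => f u ^ 2 / 2) = fun u => f u ^ 2 * (1 / 2 : ℝ) := by
    ext u
    ring
  rw [he, h.fderiv]
  ext w
  simp
  ring

theorem hessian_sq_half (hf : IsGauge f) (hv : v ≠ 0) (w w' : V) :
    fderiv ℝ (fderiv ℝ (fun u => f u ^ 2 / 2)) v w w' =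
      fderiv ℝ f v w * fderiv ℝ f v w' + f v * fderiv ℝ (fderiv ℝ f) v w w' := by
  have h : fderiv ℝ (fun u => f u ^ 2 / 2) =ᶠ[nhds v] fun u => f u • fderiv ℝ f u := by
    filter_upwards [isOpen_compl_singleton.mem_nhds hv] with u hu using hf.fderiv_sq_half hu
  rw [h.fderiv_eq, fderiv_fun_smul (hf.differentiableAt hv) (hf.differentiableAt_fderiv hv)]
  simp
  ring

/-- The fundamental tensor is non-degenerate if the Hessian has the smallest possible radical. -/
theorem eq_zero_of_hessian_sq_half (hf : IsGauge f) (hv : v ≠ 0)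
    (hrad : ∀ w, (∀ w', fderiv ℝ (fderiv ℝ f) v w w' = 0) → w ∈ Submodule.span ℝ {v})
    {w : V} (hw : ∀ w', fderiv ℝ (fderiv ℝ (fun u => f u ^ 2 / 2)) v w w' = 0) : w = 0 := by
  have hfv := (hf.pos v hv).ne'
  have h1 : fderiv ℝ f v w = 0 := by
    have := hw v
    rw [hf.hessian_sq_half hv, hf.fderiv_self hv, hf.hessian_symm hv, hf.hessian_self hv] at this
    simpa [hfv] using this
  have h2 := hrad w fun w' => by
    have := hw w'
    rw [hf.hessian_sq_half hv, h1] at this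
    simpa [hfv] using this
  obtain ⟨a, rfl⟩ := Submodule.mem_span_singleton.1 h2
  rw [map_smul, hf.fderiv_self hv] at h1
  simpa [hfv, hv] using h1

theorem contDiffOn_sq_half (hf : IsGauge f) : ContDiffOn ℝ ∞ (fun u => f u ^ 2 / 2) {0}ᶜ :=
  (hf.smooth.pow 2).div_const 2

end IsGauge

/-- At a local minimum the second derivative is non-negative. -/
theorem hessian_nonneg_of_isLocalMin {h : V → ℝ} {v : V} (hh : ContDiffAt ℝ 2 h v)
    (hmin : IsLocalMin h v) (w : V) : 0 ≤ fderiv ℝ (fderiv ℝ h) v w w := by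
  set φ : ℝ → ℝ := fun t => h (v + t • w) with hφ
  have hline (t : ℝ) : HasDerivAt (fun t : ℝ => v + t • w) w t := by
    simpa using ((hasDerivAt_id t).smul_const w).const_add v
  have hcont : ContinuousAt (fun t : ℝ => v + t • w) 0 := (hline 0).continuousAt
  have h0 : v + (0 : ℝ) • w = v := by simp
  have htend : Filter.Tendsto (fun t : ℝ => v + t • w) (nhds 0) (nhds v) := by
    simpa [ContinuousAt] using hcont
  have hd : ∀ᶠ t in nhds (0 : ℝ), HasDerivAt φ (fderiv ℝ h (v + t • w) w) t := by
    have : ∀ᶠ u in nhds v, DifferentiableAt ℝ h u := by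
      filter_upwards [hh.eventually (by simp)] with u hu using hu.differentiableAt (by simp)
    filter_upwards [htend.eventually this] with t ht
      using ht.hasFDerivAt.comp_hasDerivAt t (hline t)
  have hderiv : deriv φ =ᶠ[nhds 0] fun t => fderiv ℝ h (v + t • w) w := by
    filter_upwards [hd] with t ht using ht.deriv
  have hd2 : HasDerivAt (fun t : ℝ => fderiv ℝ h (v + t • w) w) (fderiv ℝ (fderiv ℝ h) v w w) 0 := by
    have h2 : DifferentiableAt ℝ (fderiv ℝ h) v :=
      (hh.fderiv_right (m := 1) (by norm_num)).differentiableAt (by simp)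
    have h2' : HasFDerivAt (fderiv ℝ h) (fderiv ℝ (fderiv ℝ h) v) (v + (0 : ℝ) • w) := by
      rw [h0]; exact h2.hasFDerivAt
    have := h2'.comp_hasDerivAt (0 : ℝ) (hline 0)
    simpa using this.clm_apply (hasDerivAt_const (0 : ℝ) w)
  have hdd : deriv (deriv φ) 0 = fderiv ℝ (fderiv ℝ h) v w w := by
    rw [hderiv.deriv_eq, hd2.deriv]
  have hminφ : IsLocalMin φ 0 := by
    have := htend.eventually hmin
    filter_upwards [this] with t ht
    simpa [hφ] using ht
  -- A negative second derivative would make the minimum also a maximum, hence `φ` locally constant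
  -- with vanishing second derivative.
  by_contra! hneg
  have hmax : IsLocalMax φ 0 := isLocalMax_of_deriv_deriv_neg (by rw [hdd]; exact hneg)
    hminφ.deriv_eq_zero hd.self_of_nhds.continuousAt
  have hconst : φ =ᶠ[nhds 0] fun _ => φ 0 := by
    filter_upwards [hminφ, hmax] with t h1 h2 using le_antisymm h2 h1
  have : deriv (deriv φ) 0 = 0 := by
    have h1 : deriv φ =ᶠ[nhds 0] fun _ => (0 : ℝ) := by
      filter_upwards [hconst.eventuallyEq_nhds] with t ht
      rw [ht.deriv_eq]; simp
    rw [h1.deriv_eq]; simp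
  linarith

end Gauge

/-! ### Strong convexity from non-degeneracy, by connectedness. -/

section Convexity

variable {V : Type*} [NormedAddCommGroup V] [InnerProductSpace ℝ V] [FiniteDimensional ℝ V]
  {f : V → ℝ}

/-- The fundamental tensor is positive definite where the ratio of the gauge to the Euclidean norm
is smallest. -/
theorem IsGauge.exists_hessian_sq_half_pos [Nontrivial V] (hf : IsGauge f) :
    ∃ v, v ≠ 0 ∧ ∀ w, w ≠ 0 → 0 < fderiv ℝ (fderiv ℝ (fun u => f u ^ 2 / 2)) v w w := by
  obtain ⟨v, hv, hmin⟩ := (isCompact_sphere (0 : V) 1).exists_isMinOn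
    (NormedSpace.sphere_nonempty.2 zero_le_one)
    (hf.smooth.continuousOn.mono fun v hv => by
      rintro rfl
      simp at hv)
  have hv1 : ‖v‖ = 1 := by simpa using hv
  have hv0 : v ≠ 0 := by
    rintro rfl
    simp at hv1
  have hm := hf.pos v hv0
  refine ⟨v, hv0, fun w hw => ?_⟩
  have hbound (u : V) (hu : u ≠ 0) : f v * ‖u‖ ≤ f u := by
    have hu' : 0 < ‖u‖ := norm_pos_iff.2 hu
    have h1 : f v ≤ f (‖u‖⁻¹ • u) := hmin (by simp [norm_smul, hu])
    rw [hf.hom _ _ (inv_pos.2 hu')] at h1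
    calc f v * ‖u‖ ≤ (‖u‖⁻¹ * f u) * ‖u‖ := by gcongr
      _ = f u := by field_simp
  -- By `hbound` this quadratic form touches `f² / 2` from below at `v`, so it bounds the Hessian of
  -- `f² / 2` there from below.
  set q : V → ℝ := fun u => f v ^ 2 / 2 * ‖u‖ ^ 2 with hq
  have hsq : ContDiffAt ℝ ∞ (fun u => f u ^ 2 / 2) v :=
    (hf.contDiffOn_sq_half v hv0).contDiffAt (isOpen_compl_singleton.mem_nhds hv0)
  have hqs : ContDiff ℝ ∞ q := contDiff_const.mul (contDiff_norm_sq ℝ)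
  have hlocal : IsLocalMin (fun u => f u ^ 2 / 2 - q u) v := by
    filter_upwards [isOpen_compl_singleton.mem_nhds hv0] with u hu
    have h1 := hbound u hu
    have h2 : (f v * ‖u‖) ^ 2 ≤ f u ^ 2 := by gcongr
    simp only [hq, hv1]
    nlinarith
  have hge := hessian_nonneg_of_isLocalMin
    (((hsq.sub hqs.contDiffAt)).of_le two_le_infty) hlocal w
  have hqd (u : V) : fderiv ℝ q u = (f v ^ 2) • innerSL ℝ u := by
    have := ((hasStrictFDerivAt_norm_sq u).hasFDerivAt.const_mul (f v ^ 2 / 2))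
    rw [this.fderiv]
    ext w
    simp
    ring
  have hqdd : fderiv ℝ (fderiv ℝ q) v w w = f v ^ 2 * ‖w‖ ^ 2 := by
    rw [funext hqd]
    have : HasFDerivAt (fun u : V => (f v ^ 2) • innerSL ℝ u) ((f v ^ 2) • innerSL ℝ) v :=
      ((innerSL ℝ : V →L[ℝ] V →L[ℝ] ℝ).hasFDerivAt).const_smul (f v ^ 2)
    rw [this.fderiv]
    simp only [smul_apply, smul_eq_mul]
    rw [← real_inner_self_eq_norm_sq]
    rfl
  have hev : fderiv ℝ (fun u => f u ^ 2 / 2 - q u) =ᶠ[nhds v]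
      fun u => fderiv ℝ (fun u => f u ^ 2 / 2) u - fderiv ℝ q u := by
    filter_upwards [isOpen_compl_singleton.mem_nhds hv0] with u hu
    exact fderiv_fun_sub (((hf.contDiffOn_sq_half u hu).contDiffAt
      (isOpen_compl_singleton.mem_nhds hu)).differentiableAt (by simp))
      (hqs.differentiable (by simp) u)
  rw [hev.fderiv_eq, fderiv_fun_sub
    ((hsq.fderiv_right (m := ∞) (by simp)).differentiableAt (by simp))
    ((hqs.contDiffAt.fderiv_right (m := ∞) (by simp)).differentiableAt (by simp)),
    sub_apply, sub_apply, hqdd] at hge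
  have : 0 < f v ^ 2 * ‖w‖ ^ 2 := by positivity
  linarith

/-- A gauge whose Hessians have one-dimensional radicals is strongly convex. -/
theorem IsGauge.hessian_sq_half_pos (hf : IsGauge f)
    (hrad : ∀ v, v ≠ 0 → ∀ w, (∀ w', fderiv ℝ (fderiv ℝ f) v w w' = 0) → w ∈ Submodule.span ℝ {v})
    {v w : V} (hv : v ≠ 0) (hw : w ≠ 0) :
    0 < fderiv ℝ (fderiv ℝ (fun u => f u ^ 2 / 2)) v w w := by
  have : Nontrivial V := ⟨v, 0, hv⟩
  -- In dimension one the non-zero vectors are not connected, but there every `w` is a multiple of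
  -- `v` and only the term `df ⊗ df` survives.
  rcases (Nat.succ_le_of_lt (Module.finrank_pos (R := ℝ) (M := V))).eq_or_lt with h1 | h1
  · obtain ⟨a, rfl⟩ := exists_smul_eq_of_finrank_eq_one h1.symm hv w
    have ha : a ≠ 0 := fun h => hw (by simp [h])
    have hfv := hf.pos v hv
    rw [hf.hessian_sq_half hv]
    simp only [map_smul, hf.fderiv_self hv, hf.hessian_self hv, smul_apply]
    simp only [zero_apply, mul_zero, add_zero, smul_eq_mul]
    exact mul_self_pos.2 (mul_ne_zero ha hfv.ne')
  set g : V → V →L[ℝ] V →L[ℝ] ℝ := fderiv ℝ (fderiv ℝ (fun u => f u ^ 2 / 2)) with hg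
  have hgc : ContinuousOn g {0}ᶜ := fun u hu => by
    have h2 : ContDiffAt ℝ ∞ (fun u => f u ^ 2 / 2) u :=
      (hf.contDiffOn_sq_half u hu).contDiffAt (isOpen_compl_singleton.mem_nhds hu)
    exact ((h2.fderiv_right (m := ∞) (by simp)).fderiv_right (m := ∞)
      (by simp)).continuousAt.continuousWithinAt
  have hsymm (u : V) (hu : u ≠ 0) (a b : V) : g u a b = g u b a := by
    rw [hg, hf.hessian_sq_half hu, hf.hessian_sq_half hu, hf.hessian_symm hu]
    ring
  set S : Set V := {u | u ≠ 0 ∧ ∀ w, w ≠ 0 → 0 < g u w w} with hS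
  have hSo : IsOpen S := by
    rw [isOpen_iff_mem_nhds]
    rintro u ⟨hu, hpos⟩
    have hcu : ContinuousAt g u := hgc.continuousAt (isOpen_compl_singleton.mem_nhds hu)
    -- Compactness of the sphere gives one neighbourhood of `u` on which the form is positive in all
    -- unit directions at once.
    have hev := (isCompact_sphere (0 : V) 1).eventually_forall_of_forall_eventually (x₀ := u)
      (P := fun a b => 0 < g a b b) (fun b hb => by
        have hb0 : b ≠ 0 := by
          rintro rfl
          simp at hb
        have hc : ContinuousAt (fun z : V × V => g z.1 z.2 z.2) (u, b) := by
          have h1 : ContinuousAt (fun z : V × V => g z.1) (u, b) :=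
            ContinuousAt.comp (f := Prod.fst) (by exact hcu) continuousAt_fst
          exact (h1.clm_apply continuousAt_snd).clm_apply continuousAt_snd
        exact hc.eventually (lt_mem_nhds (hpos b hb0)))
    filter_upwards [hev, isOpen_compl_singleton.mem_nhds hu] with a ha ha0
    refine ⟨ha0, fun w hw => ?_⟩
    have hw' : 0 < ‖w‖ := norm_pos_iff.2 hw
    have := ha (‖w‖⁻¹ • w) (by simp [norm_smul, hw])
    simp only [map_smul, smul_apply, smul_eq_mul] at this
    have h2 : 0 < ‖w‖⁻¹ := inv_pos.2 hw'
    exact pos_of_mul_pos_right (pos_of_mul_pos_right this h2.le) h2.le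
  have hpre : IsPreconnected ({0}ᶜ : Set V) :=
    (isConnected_compl_singleton_of_one_lt_rank (by
      rw [← Module.finrank_eq_rank]; exact_mod_cast h1) 0).isPreconnected
  obtain ⟨v₀, hv₀, hpos₀⟩ := hf.exists_hessian_sq_half_pos
  -- What remains is relative closedness: a limit of positive definite forms is positive
  -- semidefinite, and a non-degenerate semidefinite form is definite.
  refine (hpre.subset_of_closure_inter_subset hSo ⟨v₀, hv₀, hv₀, hpos₀⟩ ?_ hv).2 w hw
  rintro u ⟨huc, hu⟩
  have hu0 : u ≠ 0 := hu
  have hcu : ContinuousAt g u := hgc.continuousAt (isOpen_compl_singleton.mem_nhds hu)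
  have hnn (a : V) : 0 ≤ g u a a := by
    have hc : ContinuousAt (fun z => g z a a) u :=
      (hcu.clm_apply continuousAt_const).clm_apply continuousAt_const
    by_contra! hneg
    obtain ⟨z, hz, hzS⟩ := mem_closure_iff_nhds.1 huc _ (hc.eventually (gt_mem_nhds hneg))
    have hz' : g z a a < 0 := hz
    rcases eq_or_ne a 0 with rfl | ha
    · simp at hz'
    · exact absurd (hzS.2 a ha) hz'.not_gt
  refine ⟨hu0, fun a ha => (hnn a).lt_of_ne fun h0 => ha ?_⟩
  refine hf.eq_zero_of_hessian_sq_half hu0 (hrad u hu0) fun b => ?_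
  change g u a b = 0
  by_contra hab
  -- As `g u a a = 0`, the form on `b + t • a` is affine in `t`; if its slope were non-zero, the
  -- value of `t` chosen below would make it equal to `-1`.
  have key (t : ℝ) : 0 ≤ g u b b + 2 * t * g u a b := by
    have := hnn (b + t • a)
    simp only [map_add, map_smul, add_apply, smul_apply,
      smul_eq_mul, ← h0, hsymm u hu0 b a] at this
    linarith
  have := key (-(g u b b + 1) / (2 * g u a b))
  field_simp at this
  linarith

end Convexity

/-! ### From Gaussian curvature to the radical of the Hessian. -/

section Curvature

variable {n : ℕ} {f : EuclideanSpace ℝ (Fin n) → ℝ} {v : EuclideanSpace ℝ (Fin n)}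

/-- If the level surface of a gauge is curved at `v`, then the Hessian is non-degenerate on its
tangent space. -/
theorem IsGauge.tangent_nondegenerate (hf : IsGauge f) (hv : v ≠ 0) (hc : gaussCurvature f v ≠ 0)
    {w : EuclideanSpace ℝ (Fin n)} (hw : fderiv ℝ f v w = 0)
    (h : ∀ w', fderiv ℝ f v w' = 0 → fderiv ℝ (fderiv ℝ f) v w w' = 0) : w = 0 := by
  have hgrad : ∀ u, ∇ f u = (InnerProductSpace.toDual ℝ _).symm (fderiv ℝ f u) := fun u => rfl
  have hg0 : ∇ f v ≠ 0 := by
    intro h0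
    rw [hgrad, LinearIsometryEquiv.map_eq_zero_iff] at h0
    have := hf.fderiv_self hv
    rw [h0] at this
    exact (hf.pos v hv).ne this
  have hG : HasFDerivAt (∇ f) (((InnerProductSpace.toDual ℝ
      (EuclideanSpace ℝ (Fin n))).symm.toContinuousLinearEquiv.toContinuousLinearMap).comp
        (fderiv ℝ (fderiv ℝ f) v)) v :=
    (InnerProductSpace.toDual ℝ
      (EuclideanSpace ℝ (Fin n))).symm.toContinuousLinearEquiv.hasFDerivAt.comp v
        (hf.differentiableAt_fderiv hv).hasFDerivAt
  have hnorm : DifferentiableAt ℝ (fun u => ‖∇ f u‖⁻¹) v :=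
    (hG.differentiableAt.norm ℝ hg0).inv (norm_ne_zero_iff.2 hg0)
  have hN := hnorm.hasFDerivAt.smul hG
  -- Differentiating the factor `‖∇ f‖⁻¹` only produces a multiple of the normal `∇ f v`, which the
  -- projection kills; the rest is a multiple of the Hessian applied to `w`.
  have hker : weingarten f v ⟨w, hw⟩ = 0 := by
    have : fderiv ℝ (unitNormal f) v = _ := hN.fderiv
    rw [weingarten, this]
    simp only [LinearMap.neg_apply, neg_eq_zero, ContinuousLinearMap.coe_coe,
      ContinuousLinearMap.comp_apply]
    refine Submodule.orthogonalProjectionOnto_eq_zero_iff.2 ?_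
    rw [Submodule.mem_orthogonal']
    intro w' hw'
    have hw'' : fderiv ℝ f v w' = 0 := hw'
    simp [hgrad, inner_add_left, inner_smul_left, hw'', h w' hw'']
  have hinj : Function.Injective (weingarten f v) := by
    exact (LinearMap.equivOfDetNeZero (weingarten f v) hc).injective
  exact congrArg Subtype.val (hinj (hker.trans (map_zero _).symm))

/-- The Hessian of a gauge in linear coordinates. -/
theorem IsGauge.hessian_comp_equiv {V V' : Type*} [NormedAddCommGroup V] [NormedSpace ℝ V]
    [NormedAddCommGroup V'] [NormedSpace ℝ V'] {f : V → ℝ} (hf : IsGauge f)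
    (A : V' ≃L[ℝ] V) {v : V'} (hv : v ≠ 0) (w w' : V') :
    fderiv ℝ (fderiv ℝ (f ∘ A)) v w w' = fderiv ℝ (fderiv ℝ f) (A v) (A w) (A w') := by
  have h1 : fderiv ℝ (f ∘ A) = fun u => (fderiv ℝ f (A u)).comp (A : V' →L[ℝ] V) :=
    funext fun u => A.comp_right_fderiv
  have hd : HasFDerivAt (fun u => fderiv ℝ f (A u))
      ((fderiv ℝ (fderiv ℝ f) (A v)).comp (A : V' →L[ℝ] V)) v :=
    (hf.differentiableAt_fderiv (v := A v) (by simpa using hv)).hasFDerivAt.comp v A.hasFDerivAt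
  have h2 := hd.clm_comp (hasFDerivAt_const (A : V' →L[ℝ] V) v)
  rw [h1, h2.fderiv]
  simp

/-- If the level surfaces of a gauge are curved with respect to some Euclidean structure, then the
radicals of its Hessians are one-dimensional. -/
theorem IsGauge.radical_of_curved (hf : IsGauge f)
    (A : EuclideanSpace ℝ (Fin n) ≃L[ℝ] EuclideanSpace ℝ (Fin n))
    (hc : ∀ c : ℝ, 0 < c → ∀ v, f (A v) = c → gaussCurvature (f ∘ A) v ≠ 0)
    (hv : v ≠ 0) (w : EuclideanSpace ℝ (Fin n)) :
    (∀ w', fderiv ℝ (fderiv ℝ f) v w w' = 0) ↔ w ∈ Submodule.span ℝ {v} := by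
  have hv' : A.symm v ≠ 0 := by simpa using hv
  have h := (hf.comp_equiv A).radical_of_tangent hv'
    (fun w => (hf.comp_equiv A).tangent_nondegenerate hv'
      (hc (f v) (hf.pos v hv) _ (by simp))) (A.symm w)
  simp only [hf.hessian_comp_equiv A hv', A.apply_symm_apply] at h
  rw [← A.forall_congr_right (q := fun w' => fderiv ℝ (fderiv ℝ f) v w w' = 0)]
  simp only [Submodule.mem_span_singleton] at h ⊢
  exact h.trans (exists_congr fun a => by rw [← map_smul, A.symm.injective.eq_iff])

end Curvature

/-! ### Lagrangians in coordinates: Euler–Lagrange and Hamel equations, change of coordinates. -/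

section LocalLagrangian

variable {E : Type*} [NormedAddCommGroup E] [NormedSpace ℝ E]

/-- A function `G(x, y)`, smooth for `x ∈ U` and `y ≠ 0`, positive and positively homogeneous of
degree one in `y`, such that the radicals of its Hessians in `y` are one-dimensional. -/
structure IsLocalLagrangian (U : Set E) (G : E × E → ℝ) : Prop where
  isOpen : IsOpen U
  smooth : ContDiffOn ℝ ∞ G (U ×ˢ {0}ᶜ)
  pos : ∀ x ∈ U, ∀ y, y ≠ 0 → 0 < G (x, y)
  hom : ∀ x ∈ U, ∀ y, ∀ r : ℝ, 0 < r → G (x, r • y) = r * G (x, y)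
  radical : ∀ x ∈ U, ∀ y, y ≠ 0 → ∀ z,
    (∀ w, fderiv ℝ (fderiv ℝ G) (x, y) (0, z) (0, w) = 0) → z ∈ Submodule.span ℝ {y}

/-- The Euler–Lagrange equations at a point of a curve with position `x`, velocity `y` and
acceleration `z`. -/
def EulerLagrangeEq (G : E × E → ℝ) (x y z : E) : Prop :=
  ∀ w, fderiv ℝ (fderiv ℝ G) (x, y) (y, z) (0, w) = fderiv ℝ G (x, y) (w, 0)

/-- The Hamel equations at `(x, y)`, after contraction by homogeneity. -/
def ContractedHamelEq (G : E × E → ℝ) (x y : E) : Prop :=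
  ∀ w, fderiv ℝ (fderiv ℝ G) (x, y) (y, 0) (0, w) = fderiv ℝ G (x, y) (w, 0)

namespace IsLocalLagrangian

variable {U : Set E} {G : E × E → ℝ} {x y : E}

theorem isOpen_slit (hG : IsLocalLagrangian U G) : IsOpen (U ×ˢ ({0}ᶜ : Set E)) :=
  hG.isOpen.prod isOpen_compl_singleton

theorem slit_mem_nhds (hG : IsLocalLagrangian U G) (hx : x ∈ U) (hy : y ≠ 0) :
    U ×ˢ ({0}ᶜ : Set E) ∈ nhds (x, y) :=
  hG.isOpen_slit.mem_nhds ⟨hx, hy⟩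

theorem contDiffAt (hG : IsLocalLagrangian U G) (hx : x ∈ U) (hy : y ≠ 0) :
    ContDiffAt ℝ ∞ G (x, y) :=
  (hG.smooth (x, y) ⟨hx, hy⟩).contDiffAt (hG.slit_mem_nhds hx hy)

theorem contDiffAt_fderiv (hG : IsLocalLagrangian U G) (hx : x ∈ U) (hy : y ≠ 0) :
    ContDiffAt ℝ ∞ (fderiv ℝ G) (x, y) :=
  (hG.contDiffAt hx hy).fderiv_right (by simp)

theorem contDiffAt_hessian (hG : IsLocalLagrangian U G) (hx : x ∈ U) (hy : y ≠ 0) :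
    ContDiffAt ℝ ∞ (fderiv ℝ (fderiv ℝ G)) (x, y) :=
  (hG.contDiffAt_fderiv hx hy).fderiv_right (by simp)

theorem hasFDerivAt (hG : IsLocalLagrangian U G) (hx : x ∈ U) (hy : y ≠ 0) :
    HasFDerivAt G (fderiv ℝ G (x, y)) (x, y) :=
  ((hG.contDiffAt hx hy).differentiableAt (by simp)).hasFDerivAt

theorem hasFDerivAt_fderiv (hG : IsLocalLagrangian U G) (hx : x ∈ U) (hy : y ≠ 0) :
    HasFDerivAt (fderiv ℝ G) (fderiv ℝ (fderiv ℝ G) (x, y)) (x, y) :=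
  ((hG.contDiffAt_fderiv hx hy).differentiableAt (by simp)).hasFDerivAt

theorem hessian_symm (hG : IsLocalLagrangian U G) (hx : x ∈ U) (hy : y ≠ 0) (p q : E × E) :
    fderiv ℝ (fderiv ℝ G) (x, y) p q = fderiv ℝ (fderiv ℝ G) (x, y) q p :=
  ((hG.contDiffAt hx hy).isSymmSndFDerivAt (by simpa using two_le_infty)).eq p q

/-- Obtained by differentiating the homogeneity relation; it says that `∂G/∂x` has degree one in `y`
and `∂G/∂y` degree zero. -/
theorem fderiv_smul (hG : IsLocalLagrangian U G) (hx : x ∈ U) (hy : y ≠ 0) {r : ℝ} (hr : 0 < r)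
    (a b : E) : fderiv ℝ G (x, r • y) (a, r • b) = r * fderiv ℝ G (x, y) (a, b) := by
  set A : E × E →L[ℝ] E × E := (ContinuousLinearMap.fst ℝ E E).prod
    (r • ContinuousLinearMap.snd ℝ E E)
  have h1 : HasFDerivAt (fun p => G (A p)) ((fderiv ℝ G (x, r • y)).comp A) (x, y) :=
    HasFDerivAt.comp (x, y) (f := A) (g := G) (hG.hasFDerivAt hx (smul_ne_zero hr.ne' hy))
      A.hasFDerivAt
  have h2 : HasFDerivAt (fun p => G (A p)) (r • fderiv ℝ G (x, y)) (x, y) := by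
    refine ((hG.hasFDerivAt hx hy).const_mul r).congr_of_eventuallyEq ?_
    filter_upwards [hG.slit_mem_nhds hx hy] with p hp using hG.hom p.1 hp.1 p.2 r hr
  exact DFunLike.congr_fun (h1.unique h2) (a, b)

theorem fderiv_vertical_self (hG : IsLocalLagrangian U G) (hx : x ∈ U) (hy : y ≠ 0) :
    fderiv ℝ G (x, y) (0, y) = G (x, y) := by
  have hd := (hG.hasFDerivAt hx hy).comp y (hasFDerivAt_prodMk_right x y)
  have := fderiv_apply_self_of_posHomogeneous 1 hd.differentiableAt
    (fun r hr => by simpa using hG.hom x hx y r hr)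
  rw [hd.fderiv] at this
  simpa using this

/-- Euler's identity for `∂G/∂x`, of degree one. It collapses the left-hand side of the Hamel
equations to a first derivative. -/
theorem hessian_vertical_self_horizontal (hG : IsLocalLagrangian U G) (hx : x ∈ U) (hy : y ≠ 0)
    (w : E) : fderiv ℝ (fderiv ℝ G) (x, y) (0, y) (w, 0) = fderiv ℝ G (x, y) (w, 0) := by
  have hd := (((hG.hasFDerivAt_fderiv hx hy).comp y (hasFDerivAt_prodMk_right x y)).clm_apply
    (hasFDerivAt_const ((w, 0) : E × E) y))
  have := fderiv_apply_self_of_posHomogeneous 1 hd.differentiableAt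
    (fun r hr => by simpa using hG.fderiv_smul hx hy hr w 0)
  rw [hd.fderiv] at this
  simpa using this

/-- Euler's identity for `∂G/∂y`, of degree zero. It makes the Euler–Lagrange equations blind to
tangential acceleration. -/
theorem hessian_vertical_self_vertical (hG : IsLocalLagrangian U G) (hx : x ∈ U) (hy : y ≠ 0)
    (w : E) : fderiv ℝ (fderiv ℝ G) (x, y) (0, y) (0, w) = 0 := by
  have hd := (((hG.hasFDerivAt_fderiv hx hy).comp y (hasFDerivAt_prodMk_right x y)).clm_apply
    (hasFDerivAt_const ((0, w) : E × E) y))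
  have := fderiv_apply_self_of_posHomogeneous 0 hd.differentiableAt
    (fun r hr => by
      have h := hG.fderiv_smul hx hy hr 0 w
      have h' : ((0, r • w) : E × E) = r • (0, w) := by simp
      rw [h', map_smul, smul_eq_mul] at h
      simpa using mul_left_cancel₀ hr.ne' h)
  rw [hd.fderiv] at this
  simpa using this

theorem hessian_split (G : E × E → ℝ) (x y : E) (a b : E) (q : E × E) :
    fderiv ℝ (fderiv ℝ G) (x, y) (a, b) q =
      fderiv ℝ (fderiv ℝ G) (x, y) (a, 0) q + fderiv ℝ (fderiv ℝ G) (x, y) (0, b) q := by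
  rw [← add_apply, ← map_add]
  simp

/-- In coordinates satisfying the Hamel equations the acceleration of an extremal is tangential. -/
theorem mem_span_of_hamel (hG : IsLocalLagrangian U G) (hx : x ∈ U) (hy : y ≠ 0)
    (hH : ContractedHamelEq G x y) {z : E} (hz : EulerLagrangeEq G x y z) :
    z ∈ Submodule.span ℝ {y} :=
  hG.radical x hx y hy z fun w => by
    have h := hz w
    rw [hessian_split, hH w] at h
    simpa using h

/-- The Hamel equations hold along an extremal with tangential acceleration. -/
theorem hamel_of_mem_span (hG : IsLocalLagrangian U G) (hx : x ∈ U) (hy : y ≠ 0) {z : E}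
    (hzy : z ∈ Submodule.span ℝ {y}) (hz : EulerLagrangeEq G x y z) : ContractedHamelEq G x y := by
  intro w
  obtain ⟨a, rfl⟩ := Submodule.mem_span_singleton.1 hzy
  have h := hz w
  have h' : ((0, a • y) : E × E) = a • (0, y) := by simp
  rw [hessian_split, h', map_smul, smul_apply, hG.hessian_vertical_self_vertical hx hy] at h
  simpa using h

end IsLocalLagrangian

/-- The derivative of the momentum along a curve. -/
theorem hasDerivWithinAt_momentum {G : E × E → ℝ} {x y : ℝ → E} {z : E} {I : Set ℝ} {t : ℝ}
    (hd : DifferentiableAt ℝ (fderiv ℝ G) (x t, y t)) (hx : HasDerivWithinAt x (y t) I t)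
    (hy : HasDerivWithinAt y z I t) (w : E) :
    HasDerivWithinAt (fun s => fderiv ℝ G (x s, y s) (0, w))
      (fderiv ℝ (fderiv ℝ G) (x t, y t) (y t, z) (0, w)) I t := by
  have h1 : HasDerivWithinAt (fun s => fderiv ℝ G (x s, y s))
      (fderiv ℝ (fderiv ℝ G) (x t, y t) (y t, z)) I t :=
    HasFDerivAt.comp_hasDerivWithinAt (f := fun s => (x s, y s)) t hd.hasFDerivAt (hx.prodMk hy)
  simpa using h1.clm_apply (hasDerivWithinAt_const t I ((0, w) : E × E))

/-- The Euler–Lagrange equations are invariant under changes of coordinates. -/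
theorem EulerLagrangeEq.change_coordinates {G G' : E × E → ℝ} {τ : E → E} {x y z : E}
    (hG : ContDiffAt ℝ 2 G (x, y)) (hG' : ContDiffAt ℝ 2 G' (τ x, fderiv ℝ τ x y))
    (hτ : ContDiffAt ℝ 2 τ x) (hsurj : Function.Surjective (fderiv ℝ τ x))
    (hGG' : ∀ᶠ p : E × E in nhds (x, y), G p = G' (τ p.1, fderiv ℝ τ p.1 p.2))
    (h : EulerLagrangeEq G x y z) :
    EulerLagrangeEq G' (τ x) (fderiv ℝ τ x y)
      (fderiv ℝ τ x z + fderiv ℝ (fderiv ℝ τ) x y y) := by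
  -- `K` is the tangent map of `τ`, so that `G = G' ∘ K` near `(x, y)`.
  set K : E × E → E × E := fun p => (τ p.1, fderiv ℝ τ p.1 p.2) with hK
  have hτd : ∀ᶠ p : E × E in nhds (x, y), ContDiffAt ℝ 2 τ p.1 :=
    continuousAt_fst.eventually (hτ.eventually (by decide))
  have hDτ {u : E} (hu : ContDiffAt ℝ 2 τ u) :
      HasFDerivAt (fderiv ℝ τ) (fderiv ℝ (fderiv ℝ τ) u) u :=
    ((hu.fderiv_right (m := 1) (by norm_num)).differentiableAt (by simp)).hasFDerivAt
  have hDτfst {p : E × E} (hp : ContDiffAt ℝ 2 τ p.1) :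
      HasFDerivAt (fun q : E × E => fderiv ℝ τ q.1)
        ((fderiv ℝ (fderiv ℝ τ) p.1).comp (ContinuousLinearMap.fst ℝ E E)) p :=
    HasFDerivAt.comp (f := Prod.fst) p (hDτ hp) hasFDerivAt_fst
  have hKd {p : E × E} (hp : ContDiffAt ℝ 2 τ p.1) : HasFDerivAt K
      (((fderiv ℝ τ p.1).comp (ContinuousLinearMap.fst ℝ E E)).prod
        ((fderiv ℝ τ p.1).comp (ContinuousLinearMap.snd ℝ E E) +
          ((fderiv ℝ (fderiv ℝ τ) p.1).comp (ContinuousLinearMap.fst ℝ E E)).flip p.2)) p := by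
    refine HasFDerivAt.prodMk ?_ ?_
    · exact HasFDerivAt.comp (f := Prod.fst) p
        ((hp.differentiableAt (by simp)).hasFDerivAt) hasFDerivAt_fst
    · exact (hDτfst hp).clm_apply hasFDerivAt_snd
  have hG'd : ∀ᶠ p : E × E in nhds (x, y), ContDiffAt ℝ 2 G' (K p) :=
    (hKd hτ).continuousAt.eventually (hG'.eventually (by decide))
  have hfd : ∀ᶠ p : E × E in nhds (x, y), ∀ a b : E, fderiv ℝ G p (a, b) =
      fderiv ℝ G' (K p) (fderiv ℝ τ p.1 a,
        fderiv ℝ τ p.1 b + fderiv ℝ (fderiv ℝ τ) p.1 a p.2) := by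
    filter_upwards [hτd, hG'd, hGG'.eventually_nhds] with p h1 h2 h3 a b
    have h4 := ((h2.differentiableAt (by simp)).hasFDerivAt.comp p (hKd h1)).congr_of_eventuallyEq h3
    rw [h4.fderiv]
    simp
  intro w'
  obtain ⟨w, rfl⟩ := hsurj w'
  have hGd : HasFDerivAt (fderiv ℝ G) (fderiv ℝ (fderiv ℝ G) (x, y)) (x, y) :=
    ((hG.fderiv_right (m := 1) (by norm_num)).differentiableAt (by simp)).hasFDerivAt
  have hl := hGd.clm_apply (hasFDerivAt_const ((0, w) : E × E) (x, y))
  have hr : HasFDerivAt (fun p => fderiv ℝ G' (K p) (0, fderiv ℝ τ p.1 w)) _ (x, y) :=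
    (HasFDerivAt.comp (f := K) (x, y)
      ((hG'.fderiv_right (m := 1) (by norm_num)).differentiableAt (by simp)).hasFDerivAt
      (hKd hτ)).clm_apply
      ((hasFDerivAt_const (0 : E) (x, y)).prodMk ((hDτfst hτ).clm_apply
        (hasFDerivAt_const w (x, y))))
  have heq : (fun p => fderiv ℝ G p (0, w)) =ᶠ[nhds (x, y)]
      fun p => fderiv ℝ G' (K p) (0, fderiv ℝ τ p.1 w) := by
    filter_upwards [hfd] with p hp
    simp [hp 0 w]
  -- The momenta correspond under `Dτ`; differentiating that identity in the direction `(y, z)`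
  -- gives its rate of change along the curve.
  have hu := DFunLike.congr_fun (hl.unique (hr.congr_of_eventuallyEq heq)) (y, z)
  have hw := h w
  have hfd0 := hfd.self_of_nhds w 0
  -- Both sides of the equation acquire a second derivative of `τ`, one from `∂G/∂x` and one from
  -- the moving covector argument `Dτ w`; symmetry cancels them.
  have hsymm : fderiv ℝ (fderiv ℝ τ) x w y = fderiv ℝ (fderiv ℝ τ) x y w :=
    (hτ.isSymmSndFDerivAt (by simp)).eq w y
  have hadd (a b : E) : fderiv ℝ G' (τ x, fderiv ℝ τ x y) (a, b) =
      fderiv ℝ G' (τ x, fderiv ℝ τ x y) (a, 0) + fderiv ℝ G' (τ x, fderiv ℝ τ x y) (0, b) := by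
    rw [← map_add]
    simp
  simp at hu
  rw [hw, hfd0] at hu
  simp [hK] at hu
  rw [hadd, hsymm] at hu
  linarith

end LocalLagrangian

/-! ### Straight lines and the smoothness of their parametrization. -/

section Curves

variable {E : Type*} [NormedAddCommGroup E] [InnerProductSpace ℝ E]

/-- A curve whose acceleration is a multiple of its velocity runs along a straight line. -/
theorem exists_line_of_acceleration_mem_span {I : Set ℝ} (hI : Convex ℝ I) {x y z : ℝ → E}
    (hne : I.Nonempty) (hx : ∀ t ∈ I, HasDerivWithinAt x (y t) I t)
    (hy : ∀ t ∈ I, HasDerivWithinAt y (z t) I t) (hy0 : ∀ t ∈ I, y t ≠ 0)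
    (hz : ∀ t ∈ I, z t ∈ Submodule.span ℝ {y t}) :
    ∃ (f : ℝ → ℝ) (a b : E), a ≠ 0 ∧ (∀ t ∈ I, x t = f t • a + b) ∧
      ∀ t ∈ I, y t = ‖y t‖ • a ∧ HasDerivWithinAt f ‖y t‖ I t := by
  have hconst {g : ℝ → E} (hg : ∀ t ∈ I, HasDerivWithinAt g 0 I t) {s t : ℝ} (hs : s ∈ I)
      (ht : t ∈ I) : g s = g t := by
    have := hI.norm_image_sub_le_of_norm_hasDerivWithin_le (f := g) (f' := fun _ => 0) (C := 0) hg
      (fun _ _ => by simp) ht hs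
    simpa [sub_eq_zero] using this
  obtain ⟨t₀, ht₀⟩ := hne
  -- If `y' = c y`, then `‖y‖' = c ‖y‖`, so the unit direction does not move.
  have hdir : ∀ t ∈ I, HasDerivWithinAt (fun t => ‖y t‖⁻¹ • y t) 0 I t := by
    intro t ht
    obtain ⟨c, hc⟩ := Submodule.mem_span_singleton.1 (hz t ht)
    have hpos : 0 < ‖y t‖ := norm_pos_iff.2 (hy0 t ht)
    have hn : HasDerivWithinAt (fun t => ‖y t‖) (c * ‖y t‖) I t := by
      have h1 := ((hy t ht).norm_sq).sqrt (by positivity)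
      simp only [Real.sqrt_sq (norm_nonneg _)] at h1
      convert h1 using 1
      rw [← hc, real_inner_smul_right, real_inner_self_eq_norm_sq]
      field_simp
    have h2 := (hn.inv hpos.ne').smul (hy t ht)
    change HasDerivWithinAt ((fun t => ‖y t‖)⁻¹ • y) 0 I t
    convert h2 using 1
    rw [Pi.inv_apply, ← hc, smul_smul, ← add_smul]
    have : ‖y t‖⁻¹ * c + -(c * ‖y t‖) / ‖y t‖ ^ 2 = 0 := by
      field_simp
      ring
    rw [this, zero_smul]
  set a := ‖y t₀‖⁻¹ • y t₀ with ha
  have hya : ∀ t ∈ I, y t = ‖y t‖ • a := by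
    intro t ht
    rw [ha, ← hconst hdir ht ht₀, smul_inv_smul₀ (norm_ne_zero_iff.2 (hy0 t ht))]
  have ha0 : a ≠ 0 := by
    intro h0
    have := hya t₀ ht₀
    rw [h0, smul_zero] at this
    exact hy0 t₀ ht₀ this
  have ha1 : ‖a‖ = 1 := by
    rw [ha, norm_smul, norm_inv, norm_norm, inv_mul_cancel₀ (norm_ne_zero_iff.2 (hy0 t₀ ht₀))]
  set f : ℝ → ℝ := fun t => inner ℝ a (x t) with hf
  have hfd : ∀ t ∈ I, HasDerivWithinAt f ‖y t‖ I t := by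
    intro t ht
    have h := (innerSL ℝ a).hasFDerivAt.comp_hasDerivWithinAt t (hx t ht)
    have he : innerSL ℝ a (y t) = ‖y t‖ := by
      have h1 : inner ℝ a (‖y t‖ • a) = ‖y t‖ := by
        rw [real_inner_smul_right, real_inner_self_eq_norm_sq, ha1]
        simp
      rwa [← hya t ht] at h1
    rw [he] at h
    exact h
  refine ⟨f, a, x t₀ - f t₀ • a, ha0, fun t ht => ?_, fun t ht => ⟨hya t ht, hfd t ht⟩⟩
  have h := hconst (g := fun t => x t - f t • a) (fun s hs => by
    have h1 := (hx s hs).sub ((hfd s hs).smul_const a)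
    rwa [← hya s hs, sub_self] at h1) ht ht₀
  rw [← h]
  abel

/-- Solutions of autonomous scalar differential equations with smooth right-hand side are smooth. -/
theorem contDiffOn_of_autonomous {I V : Set ℝ} (hI : UniqueDiffOn ℝ I) {f g : ℝ → ℝ}
    (hg : ContDiffOn ℝ ∞ g V) (hV : MapsTo f I V)
    (hf : ∀ t ∈ I, HasDerivWithinAt f (g (f t)) I t) : ContDiffOn ℝ ∞ f I := by
  have hd : EqOn (derivWithin f I) (fun t => g (f t)) I :=
    fun t ht => (hf t ht).derivWithin (hI t ht)
  rw [contDiffOn_infty]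
  intro k
  -- Bootstrapping: if `f` is of class `C^k`, so is `f' = g ∘ f`.
  induction k with
  | zero => exact contDiffOn_zero.2 fun t ht => (hf t ht).continuousWithinAt
  | succ k ih =>
    have : ContDiffOn ℝ ((k : WithTop ℕ∞) + 1) f I := by
      rw [contDiffOn_succ_iff_derivWithin hI]
      refine ⟨fun t ht => (hf t ht).differentiableWithinAt, by simp, ?_⟩
      exact ((hg.of_le (by exact_mod_cast le_top)).comp ih hV).congr hd
    exact_mod_cast this

/-- Extremals of constant speed are smoothly parametrized lines if the Hamel equations hold. -/
theorem IsLocalLagrangian.exists_line {U : Set E} {G : E × E → ℝ} (hG : IsLocalLagrangian U G)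
    (hH : ∀ x ∈ U, ∀ y, y ≠ 0 → ContractedHamelEq G x y) {I : Set ℝ} (hI : Convex ℝ I)
    (hne : I.Nonempty) (hIu : UniqueDiffOn ℝ I) {x y z : ℝ → E} {c : ℝ}
    (hxU : ∀ t ∈ I, x t ∈ U) (hx : ∀ t ∈ I, HasDerivWithinAt x (y t) I t)
    (hy : ∀ t ∈ I, HasDerivWithinAt y (z t) I t) (hy0 : ∀ t ∈ I, y t ≠ 0)
    (hc : ∀ t ∈ I, G (x t, y t) = c) (hz : ∀ t ∈ I, EulerLagrangeEq G (x t) (y t) (z t)) :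
    ∃ (f : ℝ → ℝ) (a b : E), a ≠ 0 ∧ ContDiffOn ℝ ∞ f I ∧ (StrictMonoOn f I ∨ StrictAntiOn f I) ∧
      ∀ t ∈ I, x t = f t • a + b := by
  obtain ⟨f, a, b, ha, hxf, hyf⟩ := exists_line_of_acceleration_mem_span hI hne hx hy hy0
    fun t ht => hG.mem_span_of_hamel (hxU t ht) (hy0 t ht) (hH _ (hxU t ht) _ (hy0 t ht)) (hz t ht)
  have hpos : ∀ t ∈ I, 0 < ‖y t‖ := fun t ht => norm_pos_iff.2 (hy0 t ht)
  refine ⟨f, a, b, ha, ?_, Or.inl ?_, hxf⟩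
  -- Constant speed gives `c = G (x, f' • a) = f' * G (x, a)`, that is, `f' = c / G (f • a + b, a)`.
  -- This autonomous equation makes `f` smooth although the curve is only assumed twice
  -- differentiable.
  · refine contDiffOn_of_autonomous (V := (fun s : ℝ => s • a + b) ⁻¹' U) hIu
      (g := fun s => c / G (s • a + b, a)) ?_ ?_ ?_
    · refine contDiffOn_const.div (hG.smooth.comp (t := U ×ˢ {0}ᶜ)
        (g := G) (f := fun s : ℝ => (s • a + b, a)) ?_ fun s hs => ⟨hs, ha⟩)
        fun s hs => (hG.pos _ hs a ha).ne'
      exact ContDiff.contDiffOn (by fun_prop)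
    · intro t ht
      change f t • a + b ∈ U
      rw [← hxf t ht]
      exact hxU t ht
    · intro t ht
      obtain ⟨h1, h2⟩ := hyf t ht
      convert h2 using 1
      rw [← hxf t ht, div_eq_iff (hG.pos _ (hxU t ht) a ha).ne', ← hc t ht,
        ← hG.hom _ (hxU t ht) _ _ (hpos t ht), ← h1]
  · exact strictMonoOn_of_hasDerivWithinAt_pos hI (fun t ht => (hyf t ht).2.continuousWithinAt)
      (fun t ht => (hyf t (interior_subset ht)).2.mono interior_subset)
      fun t ht => hpos t (interior_subset ht)

end Curves

/-! ### Existence of geodesics with given initial position and velocity. -/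

section Existence

variable {E : Type*} [NormedAddCommGroup E] [NormedSpace ℝ E]

/-- The momentum covector `∂G/∂y`. -/
def momentum (G : E × E → ℝ) (p : E × E) : E →L[ℝ] ℝ :=
  (fderiv ℝ G p).comp (ContinuousLinearMap.inr ℝ E E)

/-- The Hessian of `G` in `y`, completed to a non-degenerate form by the square of the momentum. -/
def completedHessian (G : E × E → ℝ) (p : E × E) : E →L[ℝ] E →L[ℝ] ℝ :=
  (((ContinuousLinearMap.compL ℝ E (E × E) ℝ).flip (ContinuousLinearMap.inr ℝ E E)).comp
    (fderiv ℝ (fderiv ℝ G) p)).comp (ContinuousLinearMap.inr ℝ E E) +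
  (momentum G p).smulRight (momentum G p)

/-- The right-hand side of the equation determining the acceleration of a geodesic. -/
def geodesicForce (G : E × E → ℝ) (p : E × E) : E →L[ℝ] ℝ :=
  (fderiv ℝ G p).comp (ContinuousLinearMap.inl ℝ E E) -
    (fderiv ℝ (fderiv ℝ G) p (p.2, 0)).comp (ContinuousLinearMap.inr ℝ E E) -
    (fderiv ℝ G p (p.2, 0)) • momentum G p

/-- The acceleration of the geodesic with given position and velocity. -/
def geodesicAcceleration (G : E × E → ℝ) (p : E × E) : E :=
  (completedHessian G p).inverse (geodesicForce G p)

namespace IsLocalLagrangian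

variable {U : Set E} {G : E × E → ℝ} {x y : E}

theorem completedHessian_apply (G : E × E → ℝ) (p : E × E) (z w : E) :
    completedHessian G p z w =
      fderiv ℝ (fderiv ℝ G) p (0, z) (0, w) + fderiv ℝ G p (0, z) * fderiv ℝ G p (0, w) := by
  simp [completedHessian, momentum]

/-- Pairing with `y` kills the Hessian part and shows that the momentum vanishes on `z`. Then `z`
lies in the radical, the line of `y`, on which the momentum is non-zero since its value at `y` is `G
(x, y)`. -/
theorem completedHessian_injective (hG : IsLocalLagrangian U G) (hx : x ∈ U) (hy : y ≠ 0) :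
    Function.Injective (completedHessian G (x, y)) := by
  rw [injective_iff_map_eq_zero]
  intro z hz
  have hpos := (hG.pos x hx y hy).ne'
  have h (w : E) : fderiv ℝ (fderiv ℝ G) (x, y) (0, z) (0, w) +
      fderiv ℝ G (x, y) (0, z) * fderiv ℝ G (x, y) (0, w) = 0 := by
    rw [← completedHessian_apply, hz]
    rfl
  have h1 : fderiv ℝ G (x, y) (0, z) = 0 := by
    have := h y
    rw [hG.hessian_symm hx hy, hG.hessian_vertical_self_vertical hx hy,
      hG.fderiv_vertical_self hx hy] at this
    simpa [hpos] using this
  obtain ⟨c, rfl⟩ := Submodule.mem_span_singleton.1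
    (hG.radical x hx y hy z fun w => by simpa [h1] using h w)
  have h' : ((0, c • y) : E × E) = c • (0, y) := by simp
  rw [h', map_smul, hG.fderiv_vertical_self hx hy] at h1
  simpa [hpos, hy] using h1

variable [FiniteDimensional ℝ E]

theorem exists_completedHessian_eq (hG : IsLocalLagrangian U G) (hx : x ∈ U) (hy : y ≠ 0) :
    ∃ e : E ≃L[ℝ] (E →L[ℝ] ℝ), (e : E →L[ℝ] E →L[ℝ] ℝ) = completedHessian G (x, y) := by
  have hdim : Module.finrank ℝ E = Module.finrank ℝ (E →L[ℝ] ℝ) := by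
    rw [← (LinearMap.toContinuousLinearMap (𝕜 := ℝ) (E := E) (F' := ℝ)).finrank_eq]
    exact (Subspace.dual_finrank_eq (K := ℝ) (V := E)).symm
  refine ⟨((completedHessian G (x, y)).toLinearMap.linearEquivOfInjective
    (hG.completedHessian_injective hx hy) hdim).toContinuousLinearEquiv, ?_⟩
  ext z w
  rfl

theorem completedHessian_geodesicAcceleration (hG : IsLocalLagrangian U G) (hx : x ∈ U)
    (hy : y ≠ 0) :
    completedHessian G (x, y) (geodesicAcceleration G (x, y)) = geodesicForce G (x, y) := by
  obtain ⟨e, he⟩ := hG.exists_completedHessian_eq hx hy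
  rw [geodesicAcceleration, ← he, ContinuousLinearMap.inverse_equiv]
  simp

/-- The geodesic acceleration preserves the speed and solves the Euler–Lagrange equations. -/
theorem geodesicAcceleration_spec (hG : IsLocalLagrangian U G) (hx : x ∈ U) (hy : y ≠ 0) :
    fderiv ℝ G (x, y) (y, geodesicAcceleration G (x, y)) = 0 ∧
      EulerLagrangeEq G x y (geodesicAcceleration G (x, y)) := by
  set z := geodesicAcceleration G (x, y)
  have hpos := (hG.pos x hx y hy).ne'
  have h (w : E) : fderiv ℝ (fderiv ℝ G) (x, y) (0, z) (0, w) +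
      fderiv ℝ G (x, y) (0, z) * fderiv ℝ G (x, y) (0, w) =
      fderiv ℝ G (x, y) (w, 0) - fderiv ℝ (fderiv ℝ G) (x, y) (y, 0) (0, w) -
        fderiv ℝ G (x, y) (y, 0) * fderiv ℝ G (x, y) (0, w) := by
    rw [← completedHessian_apply, hG.completedHessian_geodesicAcceleration hx hy]
    simp [geodesicForce, momentum]
  have hsplit : fderiv ℝ G (x, y) (y, z) =
      fderiv ℝ G (x, y) (y, 0) + fderiv ℝ G (x, y) (0, z) := by
    rw [← map_add]
    simp
  -- Pairing with `w = y` turns the equation into `DG(y, z) * G = 0`. Once the speed is known to be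
  -- constant, the momentum terms on both sides agree and the Euler–Lagrange equations remain.
  have h1 : fderiv ℝ G (x, y) (y, z) = 0 := by
    have := h y
    rw [hG.hessian_symm hx hy (0, z), hG.hessian_vertical_self_vertical hx hy,
      hG.fderiv_vertical_self hx hy, hG.hessian_symm hx hy (y, 0),
      hG.hessian_vertical_self_horizontal hx hy] at this
    rw [hsplit]
    have h2 : (fderiv ℝ G (x, y) (y, 0) + fderiv ℝ G (x, y) (0, z)) * G (x, y) = 0 := by linarith
    simpa [hpos] using h2
  refine ⟨h1, fun w => ?_⟩
  rw [hessian_split]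
  have h2 := h w
  rw [hsplit] at h1
  linear_combination h2 - h1 * fderiv ℝ G (x, y) (0, w)

/-- Inversion of linear maps is smooth at isomorphisms; class `C¹` is what the local existence
theorem for differential equations needs. -/
theorem contDiffAt_geodesicAcceleration (hG : IsLocalLagrangian U G) (hx : x ∈ U) (hy : y ≠ 0) :
    ContDiffAt ℝ 1 (geodesicAcceleration G) (x, y) := by
  have h1 : ContDiffAt ℝ 1 (fderiv ℝ G) (x, y) :=
    (hG.contDiffAt_fderiv hx hy).of_le (by exact_mod_cast le_top)
  have h2 : ContDiffAt ℝ 1 (fderiv ℝ (fderiv ℝ G)) (x, y) :=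
    (hG.contDiffAt_hessian hx hy).of_le (by exact_mod_cast le_top)
  have hm : ContDiffAt ℝ 1 (momentum G) (x, y) := h1.clm_comp contDiffAt_const
  have hv : ContDiffAt ℝ 1 (fun p : E × E => (p.2, (0 : E))) (x, y) := by fun_prop
  have hM : ContDiffAt ℝ 1 (completedHessian G) (x, y) :=
    ((contDiffAt_const.clm_comp h2).clm_comp contDiffAt_const).add (hm.smulRight hm)
  have hF : ContDiffAt ℝ 1 (geodesicForce G) (x, y) :=
    ((h1.clm_comp contDiffAt_const).sub ((h2.clm_apply hv).clm_comp contDiffAt_const)).sub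
      ((h1.clm_apply hv).smul hm)
  obtain ⟨e, he⟩ := hG.exists_completedHessian_eq hx hy
  have hinv : ContDiffAt ℝ 1 (fun p => (completedHessian G p).inverse) (x, y) := by
    refine ContDiffAt.comp (x, y) (g := ContinuousLinearMap.inverse) ?_ hM
    rw [← he]
    exact contDiffAt_map_inverse e
  exact hinv.clm_apply hF

/-- Short geodesics with prescribed initial position and velocity exist. -/
theorem exists_geodesic (hG : IsLocalLagrangian U G) (hx : x ∈ U) (hy : y ≠ 0) :
    ∃ ε > 0, ∃ X Y Z : ℝ → E, X 0 = x ∧ Y 0 = y ∧ ContinuousOn Z (Ioo (-ε) ε) ∧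
      ∀ t ∈ Ioo (-ε) ε, X t ∈ U ∧ Y t ≠ 0 ∧ HasDerivAt X (Y t) t ∧ HasDerivAt Y (Z t) t ∧
        EulerLagrangeEq G (X t) (Y t) (Z t) ∧ G (X t, Y t) = G (x, y) := by
  obtain ⟨r, hr, ε, hε, hsol⟩ :=
    (contDiffAt_snd.prodMk (hG.contDiffAt_geodesicAcceleration hx hy) :
      ContDiffAt ℝ 1 (fun p : E × E => (p.2, geodesicAcceleration G p)) (x, y)
      ).exists_forall_mem_closedBall_exists_eq_forall_mem_Ioo_hasDerivAt 0
  obtain ⟨α, hα0, hα⟩ := hsol (x, y) (Metric.mem_closedBall_self hr.le)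
  simp only [zero_sub, zero_add] at hα
  have hcont : ContinuousAt α 0 := (hα 0 (by simp [hε])).continuousAt
  have hev : ∀ᶠ t in nhds (0 : ℝ), α t ∈ U ×ˢ ({0}ᶜ : Set E) :=
    hcont.eventually (by rw [hα0]; exact hG.slit_mem_nhds hx hy)
  obtain ⟨δ, hδ, hδU⟩ := Metric.eventually_nhds_iff_ball.1 hev
  -- `ε` bounds the lifetime of the solution, `δ` the time for which it stays over `U` with non-zero
  -- velocity.
  set η := min ε δ with hη
  have hsub : Ioo (-η) η ⊆ Ioo (-ε) ε :=
    Ioo_subset_Ioo (neg_le_neg (min_le_left _ _)) (min_le_left _ _)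
  have hU : ∀ t ∈ Ioo (-η) η, (α t).1 ∈ U ∧ (α t).2 ≠ 0 := fun t ht => by
    refine hδU t ?_
    rw [Real.ball_eq_Ioo, zero_sub, zero_add]
    exact ⟨(neg_le_neg (min_le_right _ _)).trans_lt ht.1, ht.2.trans_le (min_le_right _ _)⟩
  have hηpos : 0 < η := lt_min hε hδ
  have hd : ∀ t ∈ Ioo (-η) η, HasDerivAt (fun t => G (α t)) 0 t := fun t ht => by
    have h1 := (hG.hasFDerivAt (hU t ht).1 (hU t ht).2).comp_hasDerivAt t (hα t (hsub ht))
    rwa [Prod.mk.eta, (hG.geodesicAcceleration_spec (hU t ht).1 (hU t ht).2).1] at h1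
  have h0 : (0 : ℝ) ∈ Ioo (-η) η := by simp [hηpos]
  refine ⟨η, hηpos, fun t => (α t).1, fun t => (α t).2, fun t => geodesicAcceleration G (α t),
    by simp [hα0], by simp [hα0], fun t ht => ?_, fun t ht => ⟨(hU t ht).1, (hU t ht).2, ?_, ?_,
      (hG.geodesicAcceleration_spec (hU t ht).1 (hU t ht).2).2, ?_⟩⟩
  · exact (ContinuousAt.comp (f := α) (g := geodesicAcceleration G) (hG.contDiffAt_geodesicAcceleration
      (hU t ht).1 (hU t ht).2).continuousAt (hα t (hsub ht)).continuousAt).continuousWithinAt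
  · exact (hα t (hsub ht)).fst
  · exact (hα t (hsub ht)).snd
  · have := (convex_Ioo (-η) η).norm_image_sub_le_of_norm_hasDerivWithin_le (f := fun t => G (α t))
      (f' := fun _ => 0) (C := 0) (fun s hs => (hd s hs).hasDerivWithinAt)
      (fun _ _ => by simp) h0 ht
    simpa [sub_eq_zero, hα0] using this

end IsLocalLagrangian

end Existence

/-- If a line with velocity `y t`, acceleration `z t` is parametrized smoothly, then its
acceleration is a multiple of its non-zero velocity. -/
theorem acceleration_mem_span_of_line {E : Type*} [NormedAddCommGroup E] [NormedSpace ℝ E]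
    {I : Set ℝ} (hI : IsOpen I) {x y z : ℝ → E} {f : ℝ → ℝ} {a b : E} (hf : ContDiffOn ℝ 2 f I)
    (hxf : ∀ t ∈ I, x t = f t • a + b) (hx : ∀ t ∈ I, HasDerivAt x (y t) t) {t : ℝ} (ht : t ∈ I)
    (hy : HasDerivAt y (z t) t) (hy0 : y t ≠ 0) : z t ∈ Submodule.span ℝ {y t} := by
  have hya : ∀ s ∈ I, y s = deriv f s • a := by
    intro s hs
    have hfs : HasDerivAt f (deriv f s) s :=
      ((hf.contDiffAt (hI.mem_nhds hs)).differentiableAt (by simp)).hasDerivAt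
    refine (hx s hs).unique (((hfs.smul_const a).add_const b).congr_of_eventuallyEq ?_)
    filter_upwards [hI.mem_nhds hs] with u hu using hxf u hu
  have hf2 : HasDerivAt (deriv f) (deriv (deriv f) t) t := by
    have h1 : ContDiffAt ℝ 2 f t := hf.contDiffAt (hI.mem_nhds ht)
    have h2 : ContDiffAt ℝ 1 (deriv f) t := by
      have h3 : ContDiffAt ℝ 1 (fun s => fderiv ℝ f s 1) t :=
        (h1.fderiv_right (m := 1) (by norm_num)).clm_apply contDiffAt_const
      exact h3
    exact (h2.differentiableAt (by simp)).hasDerivAt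
  have hza : z t = deriv (deriv f) t • a := by
    refine hy.unique ((hf2.smul_const a).congr_of_eventuallyEq ?_)
    filter_upwards [hI.mem_nhds ht] with u hu using hya u hu
  -- Strict monotonicity of `f` would not suffice here; it is the non-zero velocity that excludes a
  -- critical point.
  have hne : deriv f t ≠ 0 := by
    intro h0
    exact hy0 (by rw [hya t ht, h0, zero_smul])
  refine Submodule.mem_span_singleton.2 ⟨deriv (deriv f) t / deriv f t, ?_⟩
  rw [hya t ht, hza, smul_smul, div_mul_cancel₀ _ hne]

/-! ### From functions on the tangent bundle to their coordinate expressions. -/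

section Bridge

variable {n : ℕ}

theorem contMDiff_tangentBundle_mk : ContMDiff
    (𝓘(ℝ, EuclideanSpace ℝ (Fin n) × EuclideanSpace ℝ (Fin n))) (𝓡 n).tangent ∞
    (fun p : EuclideanSpace ℝ (Fin n) × EuclideanSpace ℝ (Fin n) =>
      (⟨p.1, p.2⟩ : TangentBundle (𝓡 n) (EuclideanSpace ℝ (Fin n)))) := by
  intro p
  refine (Bundle.contMDiffAt_totalSpace).2 ⟨contDiff_fst.contMDiff.contMDiffAt, ?_⟩
  refine contDiff_snd.contMDiff.contMDiffAt.congr_of_eventuallyEq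
    (Filter.Eventually.of_forall fun q => ?_)
  simp

variable {M : Type*} [TopologicalSpace M] [ChartedSpace (EuclideanSpace ℝ (Fin n)) M]
  {L : TangentBundle (𝓡 n) M → ℝ} {φ ψ : OpenPartialHomeomorph M (EuclideanSpace ℝ (Fin n))}

theorem IsCoordinateSystem.mdifferentiable (hφ : IsCoordinateSystem φ) :
    φ.MDifferentiable (𝓡 n) (𝓡 n) :=
  ⟨(contMDiffOn_of_mem_maximalAtlas hφ).mdifferentiableOn (by simp),
    (contMDiffOn_symm_of_mem_maximalAtlas hφ).mdifferentiableOn (by simp)⟩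

theorem contDiffAt_transition (hφ : IsCoordinateSystem φ) (hψ : IsCoordinateSystem ψ)
    {x : EuclideanSpace ℝ (Fin n)} (hx : x ∈ φ.target) (hxψ : φ.symm x ∈ ψ.source) :
    ContDiffAt ℝ ∞ (ψ ∘ φ.symm) x := by
  rw [← contMDiffAt_iff_contDiffAt]
  exact ContMDiffAt.comp x ((contMDiffOn_of_mem_maximalAtlas hψ).contMDiffAt
    (ψ.open_source.mem_nhds hxψ)) ((contMDiffOn_symm_of_mem_maximalAtlas hφ).contMDiffAt
    (φ.open_target.mem_nhds hx))

/-- The linear isomorphism from `ℝⁿ` to a tangent space defined by a coordinate system. -/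
theorem IsCoordinateSystem.exists_equiv (hφ : IsCoordinateSystem φ)
    {x : EuclideanSpace ℝ (Fin n)} (hx : x ∈ φ.target) :
    ∃ A : EuclideanSpace ℝ (Fin n) ≃L[ℝ] EuclideanSpace ℝ (Fin n),
      ∀ L : TangentBundle (𝓡 n) M → ℝ, coordRep L φ x = fiberFun L (φ.symm x) ∘ A :=
  ⟨hφ.mdifferentiable.symm.mfderiv hx, fun _ => rfl⟩

theorem tangentMap_symm_tangentMap (hφ : IsCoordinateSystem φ) (v : TangentBundle (𝓡 n) M)
    (hv : v.1 ∈ φ.source) :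
    tangentMap (𝓡 n) (𝓡 n) φ.symm (tangentMap (𝓡 n) (𝓡 n) φ v) = v := by
  obtain ⟨p, u⟩ := v
  have h := DFunLike.congr_fun (hφ.mdifferentiable.symm_comp_deriv hv) u
  exact Bundle.TotalSpace.ext (φ.left_inv hv) (heq_of_eq h)

theorem fderiv_transition_surjective (hφ : IsCoordinateSystem φ) (hψ : IsCoordinateSystem ψ)
    {x : EuclideanSpace ℝ (Fin n)} (hx : x ∈ φ.target) (hxψ : φ.symm x ∈ ψ.source) :
    Function.Surjective (fderiv ℝ (ψ ∘ φ.symm) x) := by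
  rw [← mfderiv_eq_fderiv, mfderiv_comp x (hψ.mdifferentiable.mdifferentiableAt hxψ)
    (hφ.mdifferentiable.mdifferentiableAt_symm hx)]
  exact (hψ.mdifferentiable.mfderiv_surjective hxψ).comp
    (hφ.mdifferentiable.symm.mfderiv_surjective hx)

/-- The coordinate expressions of `L` in two coordinate systems. -/
theorem coordRep_eq_of_mem (hφ : IsCoordinateSystem φ) (hψ : IsCoordinateSystem ψ)
    {x : EuclideanSpace ℝ (Fin n)} (hx : x ∈ φ.target) (hxψ : φ.symm x ∈ ψ.source)
    (y : EuclideanSpace ℝ (Fin n)) :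
    coordRep L φ x y = coordRep L ψ ((ψ ∘ φ.symm) x) (fderiv ℝ (ψ ∘ φ.symm) x y) := by
  have h1 := hφ.mdifferentiable.mdifferentiableAt_symm hx
  have h2 := hψ.mdifferentiable.mdifferentiableAt hxψ
  have h4 : (⟨(ψ ∘ φ.symm) x, fderiv ℝ (ψ ∘ φ.symm) x y⟩ : TangentBundle (𝓡 n) _) =
      tangentMap (𝓡 n) (𝓡 n) (ψ ∘ φ.symm) ⟨x, y⟩ := by
    rw [tangentMap, mfderiv_eq_fderiv]
    rfl
  rw [coordRep, coordRep, h4, tangentMap_comp_at _ h2 h1,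
    tangentMap_symm_tangentMap hψ _ hxψ]

/-- The value of `L` on the velocity of a curve, in coordinates. -/
theorem apply_velocity (hφ : IsCoordinateSystem φ) {γ : ℝ → M} {I : Set ℝ} {t : ℝ}
    (hγ : MDifferentiableWithinAt 𝓘(ℝ, ℝ) (𝓡 n) γ I t) (hI : UniqueDiffWithinAt ℝ I t)
    (hφt : γ t ∈ φ.source) :
    L (velocity γ I t) = coordRep L φ (φ (γ t)) (derivWithin (φ ∘ γ) I t) := by
  have h2 := hφ.mdifferentiable.mdifferentiableAt hφt
  have hu : UniqueMDiffWithinAt 𝓘(ℝ, ℝ) I t := hI.uniqueMDiffWithinAt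
  have h4 : mfderivWithin 𝓘(ℝ, ℝ) (𝓡 n) (φ ∘ γ) I t =
      (mfderiv (𝓡 n) (𝓡 n) φ (γ t)).comp (mfderivWithin 𝓘(ℝ, ℝ) (𝓡 n) γ I t) :=
    mfderiv_comp_mfderivWithin t h2 hγ hu
  have h5 : (⟨φ (γ t), derivWithin (φ ∘ γ) I t⟩ : TangentBundle (𝓡 n) _) =
      tangentMap (𝓡 n) (𝓡 n) φ (velocity γ I t) := by
    rw [mfderivWithin_eq_fderivWithin] at h4
    exact Bundle.TotalSpace.ext rfl (heq_of_eq (DFunLike.congr_fun h4 (1 : ℝ)))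
  exact congrArg L ((tangentMap_symm_tangentMap hφ _ hφt).symm.trans
    (congrArg (tangentMap (𝓡 n) (𝓡 n) φ.symm) h5.symm))

/-- Homogeneity with factor 2 at the zero vector gives `L(0) = 2 L(0)`. It serves to exclude zero
velocities on curves of positive speed. -/
theorem coordRep_zero (hhom : PosHomogeneous L) (hφ : IsCoordinateSystem φ)
    {x : EuclideanSpace ℝ (Fin n)} (hx : x ∈ φ.target) : coordRep L φ x 0 = 0 := by
  obtain ⟨A, hA⟩ := hφ.exists_equiv hx
  have h := hhom (φ.symm x) 0 2 two_pos
  rw [hA L]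
  simp only [Function.comp_apply, map_zero, fiberFun]
  rw [smul_zero] at h
  have h' : L ⟨φ.symm x, (0 : EuclideanSpace ℝ (Fin n))⟩ =
    2 * L ⟨φ.symm x, (0 : EuclideanSpace ℝ (Fin n))⟩ := h
  linarith

variable [IsManifold (𝓡 n) ∞ M]

theorem contMDiff_tangentBundle_mk_fiber (p : M) : ContMDiff
    (𝓘(ℝ, EuclideanSpace ℝ (Fin n))) (𝓡 n).tangent ∞
    (fun v : EuclideanSpace ℝ (Fin n) => (⟨p, v⟩ : TangentBundle (𝓡 n) M)) := by
  intro v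
  refine (Bundle.contMDiffAt_totalSpace).2 ⟨contMDiffAt_const, ?_⟩
  have : (fun w : EuclideanSpace ℝ (Fin n) =>
      (trivializationAt (EuclideanSpace ℝ (Fin n)) (TangentSpace (𝓡 n)) p
        (⟨p, w⟩ : TangentBundle (𝓡 n) M)).2) =
      fun w => (trivializationAt (EuclideanSpace ℝ (Fin n)) (TangentSpace (𝓡 n))
        p).continuousLinearMapAt ℝ p w := by
    ext1 w
    rw [Bundle.Trivialization.continuousLinearMapAt_apply, Bundle.Trivialization.coe_linearMapAt_of_mem]
    exact FiberBundle.mem_baseSet_trivializationAt' p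
  rw [this]
  exact (ContinuousLinearMap.contDiff _).contMDiff.contMDiffAt

theorem isGauge_fiberFun (hhom : PosHomogeneous L) (hsmooth : SmoothOnSlit L)
    (hpos : PositiveOnSlit L) (p : M) : IsGauge (fiberFun L p) where
  smooth := contMDiffOn_iff_contDiffOn.1
    (ContMDiffOn.comp hsmooth (contMDiff_tangentBundle_mk_fiber p).contMDiffOn fun _ hv => hv)
  pos _ hv := hpos ⟨p, _⟩ hv
  hom v r hr := hhom p v r hr

theorem contDiffOn_coordRep (hsmooth : SmoothOnSlit L) (hφ : IsCoordinateSystem φ) :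
    ContDiffOn ℝ ∞ (fun p : EuclideanSpace ℝ (Fin n) × EuclideanSpace ℝ (Fin n) =>
      coordRep L φ p.1 p.2) (φ.target ×ˢ {0}ᶜ) := by
  rw [← contMDiffOn_iff_contDiffOn]
  have h1 : ContMDiffOn (𝓡 n).tangent (𝓡 n).tangent ∞
      (tangentMap (𝓡 n) (𝓡 n) φ.symm) (Bundle.TotalSpace.proj ⁻¹' φ.target) :=
    ((contMDiffOn_symm_of_mem_maximalAtlas hφ).contMDiffOn_tangentMapWithin (m := ∞)
      (by simp) φ.open_target.uniqueMDiffOn).congr fun v hv =>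
        (tangentMapWithin_eq_tangentMap (φ.open_target.uniqueMDiffOn v.1 hv)
          (hφ.mdifferentiable.mdifferentiableAt_symm hv)).symm
  have h2 : ContMDiffOn 𝓘(ℝ, EuclideanSpace ℝ (Fin n) × EuclideanSpace ℝ (Fin n))
      (𝓡 n).tangent ∞ (fun p => tangentMap (𝓡 n) (𝓡 n) φ.symm ⟨p.1, p.2⟩)
      (φ.target ×ˢ {0}ᶜ) :=
    ContMDiffOn.comp (g := tangentMap (𝓡 n) (𝓡 n) φ.symm)
      (f := fun p : EuclideanSpace ℝ (Fin n) × EuclideanSpace ℝ (Fin n) =>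
        (⟨p.1, p.2⟩ : TangentBundle (𝓡 n) (EuclideanSpace ℝ (Fin n)))) h1
      contMDiff_tangentBundle_mk.contMDiffOn fun p hp => hp.1
  refine ContMDiffOn.comp (g := L) (f := fun p : EuclideanSpace ℝ (Fin n) ×
    EuclideanSpace ℝ (Fin n) => tangentMap (𝓡 n) (𝓡 n) φ.symm ⟨p.1, p.2⟩) hsmooth h2
    fun p hp h0 => hp.2 ?_
  exact hφ.mdifferentiable.symm.mfderiv_injective hp.1 (h0.trans (map_zero _).symm)

/-- The second fibre derivative in terms of the second total derivative. -/
theorem hessian_vertical {E : Type*} [NormedAddCommGroup E] [NormedSpace ℝ E] {G : E × E → ℝ}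
    {x y : E} (hG : ContDiffAt ℝ 2 G (x, y)) (z w : E) :
    fderiv ℝ (fderiv ℝ fun y' => G (x, y')) y z w =
      fderiv ℝ (fderiv ℝ G) (x, y) (0, z) (0, w) := by
  have h1 : fderiv ℝ (fun y' => G (x, y')) =ᶠ[nhds y]
      fun y' => (fderiv ℝ G (x, y')).comp (ContinuousLinearMap.inr ℝ E E) := by
    have hc : ContinuousAt (fun y' : E => (x, y')) y := by fun_prop
    filter_upwards [hc.eventually (hG.eventually (by decide))] with y' hy'
    exact ((hy'.differentiableAt (by simp)).hasFDerivAt.comp y' (hasFDerivAt_prodMk_right x y')).fderiv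
  have h2 : HasFDerivAt (fderiv ℝ G) (fderiv ℝ (fderiv ℝ G) (x, y)) (x, y) :=
    ((hG.fderiv_right (m := 1) (by norm_num)).differentiableAt (by simp)).hasFDerivAt
  have h3 := (h2.comp y (hasFDerivAt_prodMk_right x y)).clm_comp
    (hasFDerivAt_const (ContinuousLinearMap.inr ℝ E E) y)
  rw [h1.fderiv_eq]
  erw [h3.fderiv]
  simp

/-- On each fibre a chart acts by a linear isomorphism, so positivity, homogeneity and the radical
of the Hessian carry over. -/
theorem isLocalLagrangian_coordRep (hhom : PosHomogeneous L) (hsmooth : SmoothOnSlit L)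
    (hpos : PositiveOnSlit L)
    (hrad : ∀ (p : M) (v : EuclideanSpace ℝ (Fin n)), v ≠ 0 → ∀ w : EuclideanSpace ℝ (Fin n),
      (∀ w', fiberHessian L p v w w' = 0) → w ∈ Submodule.span ℝ {v})
    (hφ : IsCoordinateSystem φ) :
    IsLocalLagrangian φ.target (fun p => coordRep L φ p.1 p.2) where
  isOpen := φ.open_target
  smooth := contDiffOn_coordRep hsmooth hφ
  pos x hx y hy := by
    obtain ⟨A, hA⟩ := hφ.exists_equiv hx
    simp only [hA L]
    exact hpos ⟨φ.symm x, A y⟩ (A.map_ne_zero_iff.2 hy)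
  hom x hx y r hr := by
    obtain ⟨A, hA⟩ := hφ.exists_equiv hx
    simp only [hA L, Function.comp_apply, map_smul]
    exact hhom _ _ r hr
  radical x hx y hy z hz := by
    obtain ⟨A, hA⟩ := hφ.exists_equiv hx
    have hd : ContDiffAt ℝ 2 (fun p : EuclideanSpace ℝ (Fin n) × EuclideanSpace ℝ (Fin n) =>
        coordRep L φ p.1 p.2) (x, y) :=
      ((contDiffOn_coordRep hsmooth hφ (x, y) ⟨hx, hy⟩).contDiffAt
        ((φ.open_target.prod isOpen_compl_singleton).mem_nhds ⟨hx, hy⟩)).of_le two_le_infty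
    have h := hrad (φ.symm x) (A y) (A.map_ne_zero_iff.2 hy) (A z) fun w' => by
      have h1 := hz (A.symm w')
      rw [← hessian_vertical hd] at h1
      change fderiv ℝ (fderiv ℝ (coordRep L φ x)) y z _ = 0 at h1
      rw [hA L] at h1
      rwa [(isGauge_fiberFun hhom hsmooth hpos _).hessian_comp_equiv A hy,
        A.apply_symm_apply] at h1
    obtain ⟨c, hc⟩ := Submodule.mem_span_singleton.1 h
    rw [← map_smul] at hc
    exact Submodule.mem_span_singleton.2 ⟨c, A.injective hc⟩

end Bridge

/-! ### Partial derivatives and the coordinate form of the equations. -/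

section Partials

variable {n : ℕ} {G : EuclideanSpace ℝ (Fin n) × EuclideanSpace ℝ (Fin n) → ℝ}
  {x y : EuclideanSpace ℝ (Fin n)}

theorem partialX_eq (hG : DifferentiableAt ℝ G (x, y)) (i : Fin n) :
    partialX i (fun x y => G (x, y)) x y = fderiv ℝ G (x, y) (EuclideanSpace.single i 1, 0) := by
  have h := (HasFDerivAt.comp (f := fun e => (e, y)) x hG.hasFDerivAt
    (hasFDerivAt_prodMk_left x y)).fderiv
  exact (DFunLike.congr_fun h _).trans (by simp)

theorem partialY_eq (hG : DifferentiableAt ℝ G (x, y)) (i : Fin n) :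
    partialY i (fun x y => G (x, y)) x y = fderiv ℝ G (x, y) (0, EuclideanSpace.single i 1) := by
  have h := (hG.hasFDerivAt.comp y (hasFDerivAt_prodMk_right x y)).fderiv
  exact (DFunLike.congr_fun h _).trans (by simp)

theorem partialY_partialX_eq (hG : ContDiffAt ℝ 2 G (x, y)) (i k : Fin n) :
    partialY k (partialX i (fun x y => G (x, y))) x y =
      fderiv ℝ (fderiv ℝ G) (x, y) (0, EuclideanSpace.single k 1)
        (EuclideanSpace.single i 1, 0) := by
  have hc : ContinuousAt (fun y' : EuclideanSpace ℝ (Fin n) => (x, y')) y := by fun_prop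
  have hev : (fun y' => partialX i (fun x y => G (x, y)) x y') =ᶠ[nhds y]
      fun y' => fderiv ℝ G (x, y') (EuclideanSpace.single i 1, 0) := by
    filter_upwards [hc.eventually (hG.eventually (by decide))] with y' hy'
    exact partialX_eq (hy'.differentiableAt (by simp)) i
  have h2 : HasFDerivAt (fderiv ℝ G) (fderiv ℝ (fderiv ℝ G) (x, y)) (x, y) :=
    ((hG.fderiv_right (m := 1) (by norm_num)).differentiableAt (by simp)).hasFDerivAt
  have h3 : HasFDerivAt (fun y' => fderiv ℝ G (x, y') (EuclideanSpace.single i 1, 0)) _ y :=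
    (h2.comp y (hasFDerivAt_prodMk_right x y)).clm_apply
      (hasFDerivAt_const ((EuclideanSpace.single i (1 : ℝ), 0) :
        EuclideanSpace ℝ (Fin n) × EuclideanSpace ℝ (Fin n)) y)
  rw [partialY, hev.fderiv_eq, h3.fderiv]
  simp

theorem sum_basis_apply (ℓ : EuclideanSpace ℝ (Fin n) →ₗ[ℝ] ℝ) (y : EuclideanSpace ℝ (Fin n)) :
    ∑ k, ℓ (EuclideanSpace.single k 1) * y k = ℓ y := by
  conv_rhs => rw [← (EuclideanSpace.basisFun (Fin n) ℝ).sum_repr y]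
  simp [mul_comm]

theorem ext_basis {ℓ ℓ' : EuclideanSpace ℝ (Fin n) →ₗ[ℝ] ℝ}
    (h : ∀ i, ℓ (EuclideanSpace.single i 1) = ℓ' (EuclideanSpace.single i 1))
    (w : EuclideanSpace ℝ (Fin n)) : ℓ w = ℓ' w := by
  rw [← sum_basis_apply ℓ, ← sum_basis_apply ℓ']
  simp [h]

/-- The coordinate form of the Hamel equations. -/
theorem IsLocalLagrangian.hamel_iff {U : Set (EuclideanSpace ℝ (Fin n))}
    (hG : IsLocalLagrangian U G) (hx : x ∈ U) (hy : y ≠ 0) :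
    (∀ i : Fin n, ∑ k, partialY k (partialX i (fun x y => G (x, y))) x y * y k
      = ∑ k, partialY i (partialX k (fun x y => G (x, y))) x y * y k) ↔
    ContractedHamelEq G x y := by
  have h2 : ContDiffAt ℝ 2 G (x, y) := (hG.contDiffAt hx hy).of_le two_le_infty
  simp only [partialY_partialX_eq h2]
  have h3 (i : Fin n) : ∑ k, fderiv ℝ (fderiv ℝ G) (x, y) (0, EuclideanSpace.single k 1)
      (EuclideanSpace.single i 1, 0) * y k =
      fderiv ℝ G (x, y) (EuclideanSpace.single i 1, 0) := by
    rw [← hG.hessian_vertical_self_horizontal hx hy]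
    exact sum_basis_apply (((fderiv ℝ (fderiv ℝ G) (x, y)).flip
      (EuclideanSpace.single i 1, 0)).toLinearMap ∘ₗ LinearMap.inr ℝ _ _) y
  have h4 (i : Fin n) : ∑ k, fderiv ℝ (fderiv ℝ G) (x, y) (0, EuclideanSpace.single i 1)
      (EuclideanSpace.single k 1, 0) * y k =
      fderiv ℝ (fderiv ℝ G) (x, y) (y, 0) (0, EuclideanSpace.single i 1) := by
    rw [hG.hessian_symm hx hy (y, 0)]
    exact sum_basis_apply ((fderiv ℝ (fderiv ℝ G) (x, y)
      (0, EuclideanSpace.single i 1)).toLinearMap ∘ₗ LinearMap.inl ℝ _ _) y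
  simp only [h3, h4]
  -- After contraction, the `i`-th Hamel equation is the contracted equation tested on the `i`-th
  -- basis vector; linearity in `w` does the rest.
  refine ⟨fun h w => ?_, fun h i => (h _).symm⟩
  exact ext_basis (ℓ := (fderiv ℝ (fderiv ℝ G) (x, y) (y, 0)).toLinearMap ∘ₗ LinearMap.inr ℝ _ _)
    (ℓ' := (fderiv ℝ G (x, y)).toLinearMap ∘ₗ LinearMap.inl ℝ _ _) (fun i => (h i).symm) w

/-- The coordinate form of the Euler–Lagrange equations along a curve. -/
theorem IsLocalLagrangian.eulerLagrange_iff {U : Set (EuclideanSpace ℝ (Fin n))}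
    (hG : IsLocalLagrangian U G) {X Y : ℝ → EuclideanSpace ℝ (Fin n)}
    {z : EuclideanSpace ℝ (Fin n)} {I : Set ℝ} {t : ℝ}
    (hI : UniqueDiffWithinAt ℝ I t) (hXU : X t ∈ U) (hY0 : Y t ≠ 0)
    (hX : HasDerivWithinAt X (Y t) I t) (hY : HasDerivWithinAt Y z I t) :
    (∀ i : Fin n, HasDerivWithinAt (fun s => partialY i (fun x y => G (x, y)) (X s) (Y s))
      (partialX i (fun x y => G (x, y)) (X t) (Y t)) I t) ↔ EulerLagrangeEq G (X t) (Y t) z := by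
  have hd {x y : EuclideanSpace ℝ (Fin n)} (h : (x, y) ∈ U ×ˢ ({0}ᶜ : Set _)) :
      DifferentiableAt ℝ G (x, y) := (hG.hasFDerivAt h.1 h.2).differentiableAt
  have hmom (i : Fin n) :
      HasDerivWithinAt (fun s => partialY i (fun x y => G (x, y)) (X s) (Y s))
        (fderiv ℝ (fderiv ℝ G) (X t, Y t) (Y t, z) (0, EuclideanSpace.single i 1)) I t := by
    refine (hasDerivWithinAt_momentum (hG.hasFDerivAt_fderiv hXU hY0).differentiableAt hX hY
      (EuclideanSpace.single i 1)).congr_of_eventuallyEq ?_ (partialY_eq (hd ⟨hXU, hY0⟩) i)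
    have hc : ContinuousWithinAt (fun s => (X s, Y s)) I t :=
      hX.continuousWithinAt.prodMk hY.continuousWithinAt
    filter_upwards [hc.eventually (hG.slit_mem_nhds hXU hY0)] with s hs using partialY_eq (hd hs) i
  simp only [partialX_eq (hd (x := X t) (y := Y t) ⟨hXU, hY0⟩)]
  constructor
  · intro h w
    exact ext_basis (ℓ := (fderiv ℝ (fderiv ℝ G) (X t, Y t) (Y t, z)).toLinearMap ∘ₗ
      LinearMap.inr ℝ _ _) (ℓ' := (fderiv ℝ G (X t, Y t)).toLinearMap ∘ₗ LinearMap.inl ℝ _ _)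
      (fun i => hI.eq_deriv _ (hmom i) (h i)) w
  · intro h i
    rw [← h]
    exact hmom i

end Partials

/-! ### Rectilinear coordinates and the Hamel equations. -/

section Geodesics

variable {n : ℕ} {M : Type*} [TopologicalSpace M] [ChartedSpace (EuclideanSpace ℝ (Fin n)) M]
  {L : TangentBundle (𝓡 n) M → ℝ}
  {φ : OpenPartialHomeomorph M (EuclideanSpace ℝ (Fin n))}

theorem IsInterval.uniqueDiffOn {I : Set ℝ} (hI : IsInterval I) : UniqueDiffOn ℝ I := by
  obtain ⟨a, ha, b, hb, hab⟩ := hI.2.exists_lt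
  refine uniqueDiffOn_convex hI.1.convex ((nonempty_Ioo.2 hab).mono ?_)
  exact interior_maximal (Ioo_subset_Icc_self.trans (hI.1.out ha hb)) isOpen_Ioo

/-- The Hamel equations make a coordinate system rectilinear. -/
theorem isRectilinear_of_hamel (hhom : PosHomogeneous L) (hφ : IsCoordinateSystem φ)
    (hG : IsLocalLagrangian φ.target (fun p => coordRep L φ p.1 p.2))
    (hH : HamelEquations L φ) : IsRectilinear L φ := by
  intro I γ hI hmaps hγ
  have hIc : Convex ℝ I := hI.1.convex
  have hIu : UniqueDiffOn ℝ I := hI.uniqueDiffOn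
  set X : ℝ → EuclideanSpace ℝ (Fin n) := φ ∘ γ with hX
  set Y := derivWithin X I with hY
  have hXs : ContDiffOn ℝ 2 X I := by
    rw [← contMDiffOn_iff_contDiffOn]
    exact ((contMDiffOn_of_mem_maximalAtlas hφ).of_le two_le_infty).comp hγ.contMDiffOn hmaps
  have hXd : ∀ t ∈ I, HasDerivWithinAt X (Y t) I t := fun t ht =>
    ((hXs.differentiableOn (by simp)) t ht).hasDerivWithinAt
  have hYs : ContDiffOn ℝ 1 Y I := hXs.derivWithin hIu (by norm_num)
  have hYd : ∀ t ∈ I, HasDerivWithinAt Y (derivWithin Y I t) I t := fun t ht =>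
    ((hYs.differentiableOn (by simp)) t ht).hasDerivWithinAt
  have hXU : ∀ t ∈ I, X t ∈ φ.target := fun t ht => φ.map_source (hmaps ht)
  obtain ⟨c, hc, hcI⟩ := hγ.speed
  have hcG : ∀ t ∈ I, coordRep L φ (X t) (Y t) = c := by
    intro t ht
    rw [← hcI t ht]
    exact (apply_velocity hφ (hγ.contMDiffOn.mdifferentiableOn (by simp) t ht) (hIu t ht)
      (hmaps ht)).symm
  have hY0 : ∀ t ∈ I, Y t ≠ 0 := by
    intro t ht h0
    have := hcG t ht
    rw [h0, coordRep_zero hhom hφ (hXU t ht)] at this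
    exact hc.ne this
  exact hG.exists_line (fun x hx y hy => (hG.hamel_iff hx hy).1 (hH x hx y hy)) hIc
    hI.2.nonempty hIu hXU hXd hYd hY0 hcG fun t ht =>
      (hG.eulerLagrange_iff (hIu t ht) (hXU t ht) (hY0 t ht) (hXd t ht) (hYd t ht)).1
        (hγ.extremal t ht φ hφ (hmaps ht))

/-- A curve solving the Euler–Lagrange equations with constant speed in one coordinate system is a
geodesic. -/
theorem isGeodesic_of_coordinates {I : Set ℝ} (hI : IsOpen I)
    (hG : ∀ ψ : OpenPartialHomeomorph M (EuclideanSpace ℝ (Fin n)), IsCoordinateSystem ψ →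
      IsLocalLagrangian ψ.target (fun p => coordRep L ψ p.1 p.2))
    (hφ : IsCoordinateSystem φ) {X Y Z : ℝ → EuclideanSpace ℝ (Fin n)}
    (hZ : ContinuousOn Z I) (hXU : ∀ t ∈ I, X t ∈ φ.target) (hY0 : ∀ t ∈ I, Y t ≠ 0)
    (hX : ∀ t ∈ I, HasDerivAt X (Y t) t) (hY : ∀ t ∈ I, HasDerivAt Y (Z t) t)
    (hEL : ∀ t ∈ I, EulerLagrangeEq (fun p => coordRep L φ p.1 p.2) (X t) (Y t) (Z t))
    {c : ℝ} (hc : 0 < c) (hcI : ∀ t ∈ I, coordRep L φ (X t) (Y t) = c) :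
    IsGeodesic L (φ.symm ∘ X) I := by
  -- Continuity of the acceleration `Z` makes the velocity `C¹`, and hence the curve `C²`, as the
  -- definition of a geodesic demands.
  have hYs : ContDiffOn ℝ 1 Y I := by
    have h : ContDiffOn ℝ (0 + 1) Y I := (contDiffOn_succ_iff_deriv_of_isOpen hI).2
      ⟨fun t ht => (hY t ht).differentiableAt.differentiableWithinAt, by simp,
        (contDiffOn_zero.2 hZ).congr fun t ht => (hY t ht).deriv⟩
    simpa using h
  have hXs : ContDiffOn ℝ 2 X I := by
    have h : ContDiffOn ℝ (1 + 1) X I := (contDiffOn_succ_iff_deriv_of_isOpen hI).2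
      ⟨fun t ht => (hX t ht).differentiableAt.differentiableWithinAt, by simp,
        hYs.congr fun t ht => (hX t ht).deriv⟩
    exact h.of_le (by norm_num)
  have hγ : ContMDiffOn 𝓘(ℝ, ℝ) (𝓡 n) 2 (φ.symm ∘ X) I :=
    ((contMDiffOn_symm_of_mem_maximalAtlas hφ).of_le two_le_infty).comp hXs.contMDiffOn hXU
  refine ⟨hγ, ⟨c, hc, fun t ht => ?_⟩, fun t ht ψ hψ hψt => ?_⟩
  · have hev : EqOn (φ ∘ φ.symm ∘ X) X I := fun s hs => φ.right_inv (hXU s hs)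
    rw [apply_velocity (L := L) hφ (hγ.mdifferentiableOn (by simp) t ht) (hI.uniqueDiffOn t ht)
      (φ.map_target (hXU t ht)), ← hcI t ht, derivWithin_congr hev (hev ht),
      derivWithin_of_isOpen hI ht, (hX t ht).deriv]
    simp [φ.right_inv (hXU t ht)]
  · set τ := ψ ∘ φ.symm with hτ
    have hτs {s : ℝ} (hs : s ∈ I) (hsψ : φ.symm (X s) ∈ ψ.source) : ContDiffAt ℝ 2 τ (X s) :=
      (contDiffAt_transition hφ hψ (hXU s hs) hsψ).of_le two_le_infty
    have hsrc : ∀ᶠ s in nhds t, s ∈ I ∧ φ.symm (X s) ∈ ψ.source := by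
      have hcont : ContinuousAt (φ.symm ∘ X) t := hγ.continuousOn.continuousAt (hI.mem_nhds ht)
      exact Filter.Eventually.and (hI.mem_nhds ht) (hcont.eventually (ψ.open_source.mem_nhds hψt))
    have hX'd {s : ℝ} (hs : s ∈ I) (hsψ : φ.symm (X s) ∈ ψ.source) :
        HasDerivAt (τ ∘ X) (fderiv ℝ τ (X s) (Y s)) s :=
      ((hτs hs hsψ).differentiableAt (by simp)).hasFDerivAt.comp_hasDerivAt s (hX s hs)
    have hder : (fun s => fderiv ℝ τ (X s) (Y s)) =ᶠ[nhds t] derivWithin (τ ∘ X) I := by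
      filter_upwards [hsrc] with s hs
      rw [derivWithin_of_isOpen hI hs.1, (hX'd hs.1 hs.2).deriv]
    have hDτ : HasFDerivAt (fderiv ℝ τ) (fderiv ℝ (fderiv ℝ τ) (X t)) (X t) :=
      (((hτs ht hψt).fderiv_right (m := 1) (by norm_num)).differentiableAt (by simp)).hasFDerivAt
    have hY'd : HasDerivAt (derivWithin (τ ∘ X) I)
        (fderiv ℝ τ (X t) (Z t) + fderiv ℝ (fderiv ℝ τ) (X t) (Y t) (Y t)) t := by
      have h := (hDτ.comp_hasDerivAt t (hX t ht)).clm_apply (hY t ht)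
      rw [add_comm] at h
      exact h.congr_of_eventuallyEq hder.symm
    have hsurj := fderiv_transition_surjective hφ hψ (hXU t ht) hψt
    have hder_t : derivWithin (τ ∘ X) I t = fderiv ℝ τ (X t) (Y t) := hder.self_of_nhds.symm
    have hXψ : τ (X t) ∈ ψ.target := ψ.map_source hψt
    have hY'0 : fderiv ℝ τ (X t) (Y t) ≠ 0 := fun h0 =>
      hY0 t ht (LinearMap.injective_iff_surjective.2 hsurj (h0.trans (map_zero _).symm))
    -- A geodesic must be extremal in every coordinate system, so the equations are transported from
    -- `φ` to `ψ` along the transition map `τ`.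
    have hEL' := (hEL t ht).change_coordinates
      (((hG φ hφ).contDiffAt (hXU t ht) (hY0 t ht)).of_le two_le_infty)
      (((hG ψ hψ).contDiffAt hXψ hY'0).of_le two_le_infty) (hτs ht hψt) hsurj (by
        have hopen : IsOpen (φ.target ∩ φ.symm ⁻¹' ψ.source) :=
          φ.symm.isOpen_inter_preimage ψ.open_source
        have hfst : ∀ᶠ p : EuclideanSpace ℝ (Fin n) × EuclideanSpace ℝ (Fin n) in
            nhds (X t, Y t), p.1 ∈ φ.target ∩ φ.symm ⁻¹' ψ.source :=
          continuousAt_fst.eventually (hopen.mem_nhds ⟨hXU t ht, hψt⟩)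
        filter_upwards [hfst] with p hp using coordRep_eq_of_mem hφ hψ hp.1 hp.2 p.2)
    have hEL'' : EulerLagrangeEq (fun p => coordRep L ψ p.1 p.2) ((τ ∘ X) t)
        (derivWithin (τ ∘ X) I t)
        (fderiv ℝ τ (X t) (Z t) + fderiv ℝ (fderiv ℝ τ) (X t) (Y t) (Y t)) := by
      rw [hder_t]
      exact hEL'
    refine ((hG ψ hψ).eulerLagrange_iff (hI.uniqueDiffOn t ht) hXψ (hder_t ▸ hY'0) ?_
      hY'd.hasDerivWithinAt).2 hEL''
    rw [hder_t]
    exact (hX'd ht hψt).hasDerivWithinAt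

/-- The Hamel equations hold in rectilinear coordinate systems. -/
theorem hamel_of_isRectilinear
    (hG : ∀ ψ : OpenPartialHomeomorph M (EuclideanSpace ℝ (Fin n)), IsCoordinateSystem ψ →
      IsLocalLagrangian ψ.target (fun p => coordRep L ψ p.1 p.2))
    (hφ : IsCoordinateSystem φ) (hR : IsRectilinear L φ) : HamelEquations L φ := by
  intro x hx y hy
  refine ((hG φ hφ).hamel_iff hx hy).2 ?_
  -- The given `(x, y)` is realized as initial datum of a geodesic; straightness is then exploited
  -- only at time 0.
  obtain ⟨ε, hε, X, Y, Z, hX0, hY0, hZ, h⟩ := (hG φ hφ).exists_geodesic hx hy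
  have h0 : (0 : ℝ) ∈ Ioo (-ε) ε := by simp [hε]
  have hgeo := isGeodesic_of_coordinates isOpen_Ioo hG hφ hZ (fun t ht => (h t ht).1)
    (fun t ht => (h t ht).2.1) (fun t ht => (h t ht).2.2.1) (fun t ht => (h t ht).2.2.2.1)
    (fun t ht => (h t ht).2.2.2.2.1) ((hG φ hφ).pos x hx y hy) (fun t ht => (h t ht).2.2.2.2.2)
  obtain ⟨f, a, b, -, hf, -, hline⟩ := hR (Ioo (-ε) ε) _
    ⟨ordConnected_Ioo, (infinite_of_mem_nhds 0 (isOpen_Ioo.mem_nhds h0)).nontrivial⟩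
    (fun t ht => φ.map_target (h t ht).1) hgeo
  have hspan := acceleration_mem_span_of_line isOpen_Ioo (x := X) (z := Z)
    (hf.of_le two_le_infty)
    (fun t ht => (φ.right_inv (h t ht).1).symm.trans (hline t ht)) (fun t ht => (h t ht).2.2.1) h0
    (h 0 h0).2.2.2.1 (h 0 h0).2.1
  have := (hG φ hφ).hamel_of_mem_span (h 0 h0).1 (h 0 h0).2.1 hspan (h 0 h0).2.2.2.2.1
  rwa [hX0, hY0] at this

end Geodesics

end FinslerSpace

end

theorem theorem1 {n : ℕ} {M : Type*} [TopologicalSpace M]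
    [ChartedSpace (EuclideanSpace ℝ (Fin n)) M] [IsManifold (𝓡 n) ∞ M]
    (hM : ∃ φ : OpenPartialHomeomorph M (EuclideanSpace ℝ (Fin n)),
      FinslerSpace.IsCoordinateSystem φ ∧ φ.source = univ)
    (L : TangentBundle (𝓡 n) M → ℝ)
    (hhom : FinslerSpace.PosHomogeneous L)
    (hsmooth : FinslerSpace.SmoothOnSlit L)
    (hpos : FinslerSpace.PositiveOnSlit L)
    (hcurv : FinslerSpace.LevelSurfacesCurved L) :
    (∀ (p : M) (v : EuclideanSpace ℝ (Fin n)), v ≠ 0 →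
      Module.finrank ℝ (LinearMap.range (FinslerSpace.fiberHessian L p v).toLinearMap) = n - 1) ∧
    FinslerSpace.IsPseudoFinsler L ∧
    FinslerSpace.IsFinsler L ∧
    (FinslerSpace.IsProjectivelyFlat L ↔
      ∃ φ : OpenPartialHomeomorph M (EuclideanSpace ℝ (Fin n)),
        FinslerSpace.IsCoordinateSystem φ ∧ φ.source = univ ∧ FinslerSpace.HamelEquations L φ) ∧
    (FinslerSpace.IsLocallyProjectivelyFlat L ↔
      ∀ p : M, ∃ φ : OpenPartialHomeomorph M (EuclideanSpace ℝ (Fin n)),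
        FinslerSpace.IsCoordinateSystem φ ∧ p ∈ φ.source ∧ FinslerSpace.HamelEquations L φ) := by
  have hrad : ∀ (p : M) (v : EuclideanSpace ℝ (Fin n)), v ≠ 0 → ∀ w : EuclideanSpace ℝ (Fin n),
      (∀ w', FinslerSpace.fiberHessian L p v w w' = 0) ↔ w ∈ Submodule.span ℝ {v} := by
    intro p v hv w
    obtain ⟨A, hA⟩ := hcurv p
    exact (FinslerSpace.isGauge_fiberFun hhom hsmooth hpos p).radical_of_curved A hA hv w
  have hG (ψ : OpenPartialHomeomorph M (EuclideanSpace ℝ (Fin n)))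
      (hψ : FinslerSpace.IsCoordinateSystem ψ) :=
    FinslerSpace.isLocalLagrangian_coordRep hhom hsmooth hpos
      (fun p v hv w => (hrad p v hv w).1) hψ
  -- The equivalence holds for each coordinate system separately, so the global and the local
  -- statement both follow by quantifying over charts.
  have hiff (ψ : OpenPartialHomeomorph M (EuclideanSpace ℝ (Fin n)))
      (hψ : FinslerSpace.IsCoordinateSystem ψ) :
      FinslerSpace.IsRectilinear L ψ ↔ FinslerSpace.HamelEquations L ψ :=
    ⟨FinslerSpace.hamel_of_isRectilinear hG hψ,
      FinslerSpace.isRectilinear_of_hamel hhom hψ (hG ψ hψ)⟩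
  refine ⟨fun p v hv => ?_, ⟨hsmooth, hhom, hrad⟩, ⟨hsmooth, hpos, hhom, fun p v hv w hw => ?_⟩,
    ?_, ?_⟩
  · have hker : LinearMap.ker (FinslerSpace.fiberHessian L p v).toLinearMap =
        Submodule.span ℝ {v} := by
      ext w
      rw [← hrad p v hv w, LinearMap.mem_ker]
      exact DFunLike.ext_iff
    have h := LinearMap.finrank_range_add_finrank_ker
      (FinslerSpace.fiberHessian L p v).toLinearMap
    rw [hker, finrank_span_singleton hv, finrank_euclideanSpace_fin] at h
    exact Nat.eq_sub_of_add_eq h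
  · exact (FinslerSpace.isGauge_fiberFun hhom hsmooth hpos p).hessian_sq_half_pos
      (fun v hv w => (hrad p v hv w).1) hv hw
  · exact exists_congr fun φ => and_congr_right fun hφ => and_congr_right fun _ => hiff φ hφ
  · exact forall_congr' fun p => exists_congr fun φ => and_congr_right fun hφ =>
      and_congr_right fun _ => hiff φ hφ
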